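/- **Functional equations.** Let $q\ge 1$ be an integer and let $X=(VX,EX)$ be a countable $(q+1)$-regular simple graph (not necessarily connected). Let $\Gamma$ be a group of automorphisms of $X$ acting freely (no $\gamma\neq 1$ in $\Gamma$ fixes a vertex) and with finitely many orbits on $VX$; put $B=X/\Gamma$, let $|VB|$ be the number of $\Gamma$-orbits of vertices, and let $\chi(B)=|VB|-|EB|$, where $|EB|$ is half the number of $\Gamma$-orbits of oriented edges. A reduced closed path is a closed path of length $\geq 1$ without backtracking and without tail; it is primitive if it is not obtained by going $n\ge 2$ times around a closed path. A prime cycle is a primitive reduced closed path up to the choice of its origin; $|C|$ is its length, $\Gamma_C=\{\gamma\in\Gamma:\gamma C=C\}$ its stabilizer, and $[\mathcal P]_\Gamma$ is the set of $\Gamma$-orbits of prime cycles. Let $A$ be the adjacency operator on $\ell^2(VX)$ and $\Delta(u)=(1+qu^2)I-uA$. For a bounded operator $T$ on $\ell^2(VX)$ commuting with $\Gamma$ let $\mathrm{Tr}_\Gamma(T)=\sum_{x\in F}T(x,x)$, where $F$ is a set of representatives of $VX/\Gamma$; if $0\notin\mathrm{conv}\,\sigma(T)$, let $$\mathrm{det}_\Gamma(T)=\exp\mathrm{Tr}_\Gamma\Bigl(\frac1{2\pi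 i}\int_{\partial D}\log\lambda\,(\lambda-T)^{-1}d\lambda\Bigr),$$ where $D$ is an open disc containing $\mathrm{conv}\,\sigma(T)$ whose closure omits $0$, and $\log$ is a branch of the logarithm on a neighbourhood of $\overline D$ (the result does not depend on these choices). Let $$\Omega=\mathbb C\setminus\Bigl(\{|u|^2=\tfrac1q\}\cup\{x\in\mathbb R:\tfrac1q\le|x|\le1\}\Bigr).$$ Then $0\notin\mathrm{conv}\,\sigma(\Delta(u))$ for every $u\in\Omega$, and the function $$Z_{X,\Gamma}(u)=(1-u^2)^{\chi(B)}\,\mathrm{det}_\Gamma(\Delta(u))^{-1},\qquad u\in\Omega,$$ extends the Ihara zeta function: for $|u|<\frac1q$ the Euler product below converges unconditionally and $$Z_{X,\Gamma}(u)=\prod_{[C]\in[\mathcal P]_\Gamma}(1-u^{|C|})^{-1/|\Gamma_C|}.$$ Moreover, for all $u\in\Omega$ with $u\neq0$ one has $\frac1{qu}\in\Omega$, and (i) $\Lambda(u):=(1-u^2)^{-\chi(B)}(1-u^2)^{|VB|/2}(1-q^2u^2)^{|VB|/2}Z_{X,\Gamma}(u)$ satisfies $\Lambda(u)=(-1)^{|VB|}\,\Lambda\bigl(\tfrac1{qu}\bigr)$;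 (ii) $\xi(u):=(1-u^2)^{-\chi(B)}(1-u)^{|VB|}(1-qu)^{|VB|}Z_{X,\Gamma}(u)$ satisfies $\xi(u)=\xi\bigl(\tfrac1{qu}\bigr)$; (iii) $\Xi(u):=(1-u^2)^{-\chi(B)}(1+qu^2)^{|VB|}Z_{X,\Gamma}(u)$ satisfies $\Xi(u)=\Xi\bigl(\tfrac1{qu}\bigr)$. Non-integral powers are principal powers. -/

import Mathlib

noncomputable section

namespace IharaPeriodic

/-! ### Closed paths and cycles -/

/-- A closed path `(v₀, …, v_m = v₀)` of length `m ≥ 1` in a simple graph. The vertices are indexed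
by `ℕ`, periodically with period `m`, so that indices are read modulo `m`. -/
@[ext]
structure ClosedPath {V : Type*} (G : SimpleGraph V) where
  len : ℕ
  vert : ℕ → V
  len_pos : 0 < len
  periodic : ∀ i, vert (i + len) = vert i
  adj : ∀ i, G.Adj (vert i) (vert (i + 1))

namespace ClosedPath

variable {V : Type*} {G : SimpleGraph V}

/-- No backtracking: `v_{i-1} ≠ v_{i+1}` for `1 ≤ i ≤ m - 1`. -/
def IsProper (C : ClosedPath G) : Prop :=
  ∀ i, 1 ≤ i → i + 1 ≤ C.len → C.vert (i - 1) ≠ C.vert (i + 1)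

/-- There is `1 ≤ k ≤ [m/2] - 1` with `v_j = v_{m-j}` for `j = 1, …, k`. -/
def HasTail (C : ClosedPath G) : Prop :=
  ∃ k, 1 ≤ k ∧ k + 1 ≤ C.len / 2 ∧ ∀ j, 1 ≤ j → j ≤ k → C.vert j = C.vert (C.len - j)

/-- Reduced closed paths: no backtracking and no tail. -/
def IsReduced (C : ClosedPath G) : Prop := C.IsProper ∧ ¬ C.HasTail

/-- Primitive: not obtained by going `n ≥ 2` times around some closed path. -/
def IsPrimitive (C : ClosedPath G) : Prop :=
  ¬ ∃ (D : ClosedPath G) (n : ℕ), 2 ≤ n ∧ C.len = n * D.len ∧ ∀ j, C.vert j = D.vert j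

theorem vert_add_mul (C : ClosedPath G) (i n : ℕ) : C.vert (i + n * C.len) = C.vert i := by
  induction n with
  | zero => simp
  | succ n ih => rw [Nat.succ_mul, ← add_assoc, C.periodic, ih]

/-- Two closed paths are equivalent if they differ by a shift of the origin. -/
instance rotation (G : SimpleGraph V) : Setoid (ClosedPath G) where
  r C D := C.len = D.len ∧ ∃ k, ∀ j, D.vert j = C.vert (j + k)
  iseqv := by
    refine ⟨fun C => ⟨rfl, 0, fun j => rfl⟩, ?_, ?_⟩
    · rintro C D ⟨h, k, hk⟩
      refine ⟨h.symm, k * C.len - k, fun j => ?_⟩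
      have : k ≤ k * C.len := Nat.le_mul_of_pos_right k C.len_pos
      rw [hk, add_assoc, Nat.sub_add_cancel this, vert_add_mul]
    · rintro C D E ⟨h, k, hk⟩ ⟨h', k', hk'⟩
      exact ⟨h.trans h', k' + k, fun j => by rw [hk', hk, add_assoc]⟩

/-- Automorphisms of the graph act on closed paths vertex by vertex. -/
instance : MulAction (G ≃g G) (ClosedPath G) where
  smul γ C :=
    { len := C.len
      vert := fun i => γ (C.vert i)
      len_pos := C.len_pos
      periodic := fun i => by rw [C.periodic]
      adj := fun i => γ.map_adj_iff.2 (C.adj i) }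
  one_smul _ := rfl
  mul_smul _ _ _ := rfl

end ClosedPath

/-- A cycle: a closed path up to the choice of its origin. -/
def PathCycle {V : Type*} (G : SimpleGraph V) : Type _ := Quotient (ClosedPath.rotation G)

namespace PathCycle

variable {V : Type*} {G : SimpleGraph V}

/-- The length `|C|` of a cycle. -/
def len : PathCycle G → ℕ := Quotient.lift ClosedPath.len fun _ _ h => h.1

instance : MulAction (G ≃g G) (PathCycle G) where
  smul γ := Quotient.map (fun C => γ • C) fun _ _ ⟨h, k, hk⟩ =>
    ⟨h, k, fun j => congrArg γ (hk j)⟩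
  one_smul := by rintro ⟨C⟩; rfl
  mul_smul := by rintro γ γ' ⟨C⟩; rfl

/-- Prime cycles: the classes of primitive reduced closed paths. -/
def IsPrime (c : PathCycle G) : Prop :=
  ∃ C : ClosedPath G, C.IsReduced ∧ C.IsPrimitive ∧ (Quotient.mk _ C : PathCycle G) = c

end PathCycle

section zeta

variable {V : Type*} (G : SimpleGraph V) (Γ : Subgroup (G ≃g G))

/-- The set `[𝒫]_Γ` of `Γ`-equivalence classes of prime cycles. -/
def PrimeClass : Type _ :=
  Quotient ((MulAction.orbitRel Γ (PathCycle G)).comap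
    (Subtype.val : {c : PathCycle G // c.IsPrime} → PathCycle G))

/-- The factor `(1 - u^|C|)^(-1/|Γ_C|)` of the Euler product; it is computed on a representative
`C`, on which it does not depend. -/
def eulerFactor (u : ℂ) (P : PrimeClass G Γ) : ℂ :=
  (1 - u ^ (Quotient.out P).1.len) ^
    (-(1 / (Nat.card (MulAction.stabilizer Γ (Quotient.out P).1) : ℂ)))

/-- `|VB|`, the number of vertices of the quotient `B = X/Γ`. -/
def cardVB : ℕ := Nat.card (MulAction.orbitRel.Quotient Γ V)

/-- The number of oriented edges of the quotient `B = X/Γ`: the number of `Γ`-orbits of pairs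
`(v, w)` of adjacent vertices. -/
def cardOrientedEB : ℕ :=
  Nat.card (Quotient ((MulAction.orbitRel Γ (V × V)).comap
    (Subtype.val : {p : V × V // G.Adj p.1 p.2} → V × V)))

/-- The Euler characteristic `χ(B) = |VB| - |EB|`, where the number `|EB|` of (geometric) edges is
half the number of oriented edges. -/
def eulerChar : ℚ := cardVB G Γ - cardOrientedEB G Γ / 2

end zeta

/-! ### The adjacency operator, the trace and the determinant -/

/-- The Hilbert space `ℓ²(V)`. -/
abbrev L2 (V : Type*) : Type _ := lp (fun _ : V => ℂ) 2

section adjacency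

variable {V : Type*} (G : SimpleGraph V) [G.LocallyFinite]

theorem sum_adj_sq_le {d : ℕ} (hd : ∀ v, G.degree v ≤ d) (f : L2 V) (s : Finset V) :
    ∑ x ∈ s, ‖∑ y ∈ G.neighborFinset x, f y‖ ^ (2 : ENNReal).toReal
      ≤ (d * ‖f‖) ^ (2 : ENNReal).toReal := by
  classical
  simp only [ENNReal.toReal_ofNat, Real.rpow_ofNat]
  have h1 : ∀ x, ‖∑ y ∈ G.neighborFinset x, f y‖ ^ 2
      ≤ d * ∑ y ∈ G.neighborFinset x, ‖f y‖ ^ 2 := fun x => by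
    calc ‖∑ y ∈ G.neighborFinset x, f y‖ ^ 2
        ≤ (∑ y ∈ G.neighborFinset x, ‖f y‖) ^ 2 := by
          gcongr
          exact norm_sum_le _ _
      _ ≤ (G.neighborFinset x).card * ∑ y ∈ G.neighborFinset x, ‖f y‖ ^ 2 :=
          sq_sum_le_card_mul_sum_sq
      _ ≤ d * ∑ y ∈ G.neighborFinset x, ‖f y‖ ^ 2 := by
          gcongr
          exact hd x
  set t : Finset V := s.biUnion fun x => G.neighborFinset x with ht
  have h2 : ∑ x ∈ s, ∑ y ∈ G.neighborFinset x, ‖f y‖ ^ 2 ≤ ∑ y ∈ t, d * ‖f y‖ ^ 2 := by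
    rw [Finset.sum_comm' (t' := t) (s' := fun y => s.filter fun x => G.Adj x y)
      (by
        intro x y
        simp only [ht, SimpleGraph.mem_neighborFinset, Finset.mem_filter, Finset.mem_biUnion]
        exact ⟨fun h => ⟨⟨h.1, h.2⟩, x, h.1, h.2⟩, fun h => h.1⟩)]
    refine Finset.sum_le_sum fun y _ => ?_
    rw [Finset.sum_const, nsmul_eq_mul]
    gcongr
    refine (Finset.card_le_card fun x hx => ?_).trans (hd y)
    rw [SimpleGraph.mem_neighborFinset]
    exact (Finset.mem_filter.1 hx).2.symm
  have h3 : ∑ y ∈ t, ‖f y‖ ^ 2 ≤ ‖f‖ ^ 2 := by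
    have := lp.sum_rpow_le_norm_rpow (p := 2) (by simp) f t
    simpa using this
  calc ∑ x ∈ s, ‖∑ y ∈ G.neighborFinset x, f y‖ ^ 2
      ≤ ∑ x ∈ s, d * ∑ y ∈ G.neighborFinset x, ‖f y‖ ^ 2 := Finset.sum_le_sum fun x _ => h1 x
    _ = d * ∑ x ∈ s, ∑ y ∈ G.neighborFinset x, ‖f y‖ ^ 2 := by rw [Finset.mul_sum]
    _ ≤ d * ∑ y ∈ t, d * ‖f y‖ ^ 2 := by gcongr
    _ = d * (d * ∑ y ∈ t, ‖f y‖ ^ 2) := by rw [← Finset.mul_sum]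
    _ ≤ d * (d * ‖f‖ ^ 2) := by gcongr
    _ = (d * ‖f‖) ^ 2 := by ring

/-- The adjacency operator `(A f)(x) = ∑_{y ∼ x} f(y)` on `ℓ²(V)`, for a graph with degrees
bounded by `d`. -/
def adjOp {d : ℕ} (hd : ∀ v, G.degree v ≤ d) : L2 V →L[ℂ] L2 V :=
  LinearMap.mkContinuous
    { toFun := fun f => ⟨fun x => ∑ y ∈ G.neighborFinset x, f y,
        memℓp_gen' (sum_adj_sq_le G hd f)⟩
      map_add' := fun f g => by
        ext x
        exact Finset.sum_add_distrib
      map_smul' := fun c f => by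
        ext x
        simp [Finset.mul_sum] }
    d fun f => lp.norm_le_of_forall_sum_le (by simp) (by positivity) (sum_adj_sq_le G hd f)

end adjacency

open Classical in
/-- The trace `Tr_Γ(T) = ∑_{x ∈ F} T(x, x)`, where `F` is a set of representatives of the
`Γ`-orbits in `V` and `T(x, x)` is the matrix coefficient `⟨δ_x, T δ_x⟩`; on operators commuting
with the action of `Γ` it does not depend on the choice of `F`. -/
def traceΓ {V : Type*} (G : SimpleGraph V) (Γ : Subgroup (G ≃g G)) (T : L2 V →L[ℂ] L2 V) : ℂ :=
  ∑ᶠ o : MulAction.orbitRel.Quotient Γ V, (T (lp.single 2 (Quotient.out o) 1)) (Quotient.out o)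

/-- A compact convex set of complex numbers that omits `0` lies in an open disc whose closure
omits `0`. -/
theorem exists_disc {K : Set ℂ} (hK : IsCompact K) (hc : Convex ℝ K) (h0 : (0 : ℂ) ∉ K) :
    ∃ D : ℂ × ℝ, K ⊆ Metric.ball D.1 D.2 ∧ 0 < D.2 ∧ D.2 < ‖D.1‖ := by
  rcases K.eq_empty_or_nonempty with rfl | hne
  · exact ⟨(1, 1 / 2), by simp, by norm_num, by norm_num⟩
  obtain ⟨p, hp, hmin⟩ := exists_norm_eq_iInf_of_complete_convex hne hK.isComplete hc 0
  have hin := (norm_eq_iInf_iff_real_inner_le_zero hc hp).1 hmin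
  have hp0 : 0 < ‖p‖ := norm_pos_iff.2 fun h => h0 (h ▸ hp)
  obtain ⟨M, hM⟩ := hK.isBounded.exists_norm_le
  have hM0 : 0 ≤ M := (norm_nonneg p).trans (hM p hp)
  set t : ℝ := (M ^ 2 + 1) / ‖p‖ ^ 2 with ht
  have ht0 : 0 < t := by positivity
  have htp : t * ‖p‖ ^ 2 = M ^ 2 + 1 := by rw [ht]; field_simp
  have key : ∀ z ∈ K, dist z (t • p) < ‖t • p‖ := fun z hz => by
    have h1 : ‖p‖ ^ 2 ≤ inner ℝ z p := by
      have := hin z hz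
      rw [zero_sub, inner_neg_left, inner_sub_right, real_inner_self_eq_norm_sq,
        real_inner_comm] at this
      linarith
    have h2 : dist z (t • p) ^ 2 < ‖t • p‖ ^ 2 := by
      rw [dist_eq_norm, norm_sub_sq_real, real_inner_smul_right]
      have h3 : ‖z‖ ^ 2 ≤ M ^ 2 := by
        gcongr
        exact hM z hz
      have h4 : t * ‖p‖ ^ 2 ≤ t * inner ℝ z p := by gcongr
      nlinarith [sq_nonneg M]
    exact lt_of_pow_lt_pow_left₀ 2 (norm_nonneg _) h2
  obtain ⟨z₀, hz₀, hmax⟩ := hK.exists_isMaxOn hne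
    (Continuous.continuousOn (f := fun z => dist z (t • p)) (by fun_prop))
  obtain ⟨r, hr1, hr2⟩ := exists_between (key z₀ hz₀)
  exact ⟨(t • p, r), fun z hz => lt_of_le_of_lt (hmax hz) hr1, dist_nonneg.trans_lt hr1, hr2⟩

theorem isCompact_convexHull {s : Set ℂ} (hs : IsCompact s) : IsCompact (convexHull ℝ s) := by
  have heq : convexHull ℝ s = ⋃ n ∈ Finset.range 4,
      (fun p : (Fin n → ℝ) × (Fin n → ℂ) => ∑ i, p.1 i • p.2 i) ''
        (stdSimplex ℝ (Fin n) ×ˢ Set.univ.pi fun _ => s) := by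
    ext x
    simp only [Set.mem_iUnion, Set.mem_image, Set.mem_prod, Set.mem_univ_pi, Prod.exists,
      exists_prop]
    constructor
    · intro hx
      obtain ⟨ι, _, z, w, hz, hind, hw, hw1, rfl⟩ := eq_pos_convex_span_of_mem_convexHull hx
      have hcard : Fintype.card ι ≤ 3 := by
        have h1 := hind.card_le_finrank_succ
        have h2 := Submodule.finrank_le (vectorSpan ℝ (Set.range z))
        rw [Complex.finrank_real_complex] at h2
        omega
      let e := (Fintype.equivFin ι).symm
      refine ⟨Fintype.card ι, Finset.mem_range.2 (by omega), fun i => w (e i), fun i => z (e i),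
        ⟨⟨fun i => (hw _).le, ?_⟩, fun i => hz ⟨_, rfl⟩⟩, ?_⟩
      · rw [← hw1]
        exact e.sum_comp w
      · exact e.sum_comp fun i => w i • z i
    · rintro ⟨n, -, w, z, ⟨⟨hw, hw1⟩, hz⟩, rfl⟩
      exact (convex_convexHull ℝ s).sum_mem (fun i _ => hw i) hw1
        fun i _ => subset_convexHull ℝ s (hz i)
  rw [heq]
  refine (Finset.range 4).isCompact_biUnion fun n _ => ?_
  refine ((isCompact_stdSimplex ℝ (Fin n)).prod (isCompact_univ_pi fun _ => hs)).image ?_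
  fun_prop

section determinant

variable {V : Type*}

/-- The domain of the analytic determinant: `0` is not in the convex hull of the spectrum. -/
def InDetDomain (T : L2 V →L[ℂ] L2 V) : Prop := (0 : ℂ) ∉ convexHull ℝ (spectrum ℂ T)

theorem InDetDomain.exists_disc {T : L2 V →L[ℂ] L2 V} (h : InDetDomain T) :
    ∃ D : ℂ × ℝ, convexHull ℝ (spectrum ℂ T) ⊆ Metric.ball D.1 D.2 ∧ 0 < D.2 ∧ D.2 < ‖D.1‖ :=
  IharaPeriodic.exists_disc (isCompact_convexHull (spectrum.isCompact T)) (convex_convexHull ℝ _) h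

/-- `(1/2πi) ∮ log λ (λ - T)⁻¹ dλ` over the circle of centre `c` and radius `r < |c|`, where
`log λ := Log c + Log (λ/c)` is a branch of the logarithm on the disc `|λ - c| < |c|`. -/
def logOnDisc (T : L2 V →L[ℂ] L2 V) (c : ℂ) (r : ℝ) : L2 V →L[ℂ] L2 V :=
  (2 * Real.pi * Complex.I : ℂ)⁻¹ •
    ∮ z in C(c, r), (Complex.log c + Complex.log (z / c)) • resolvent T z

open Classical in
/-- The analytic determinant `det_Γ(T) = exp (Tr_Γ (log T))`, where `log T` is given by the
holomorphic functional calculus on a simply connected region containing the convex hull of the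
spectrum of `T`. The region is taken to be a disc whose closure omits `0`; one exists whenever `0` is
not in that convex hull, and the value does not depend on it. -/
def detΓ (G : SimpleGraph V) (Γ : Subgroup (G ≃g G)) (T : L2 V →L[ℂ] L2 V) : ℂ :=
  if h : InDetDomain T then
    Complex.exp (traceΓ G Γ (logOnDisc T h.exists_disc.choose.1 h.exists_disc.choose.2))
  else 0

end determinant

/-! ### The zeta function of a regular periodic graph and its completions -/

/-- The plane without the circle `|u|² = 1/q` and the real points with `1/q ≤ |u| ≤ 1`. -/
def Omega (q : ℕ) : Set ℂ :=
  {u | u.re ^ 2 + u.im ^ 2 ≠ 1 / q ∧ ¬ (u.im = 0 ∧ 1 / (q : ℝ) ≤ |u.re| ∧ |u.re| ≤ 1)}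

section completed

variable {V : Type*} (G : SimpleGraph V) [G.LocallyFinite] {q : ℕ}
  (hreg : G.IsRegularOfDegree (q + 1)) (Γ : Subgroup (G ≃g G)) (u : ℂ)

/-- `Δ(u) = (1 + q u²) I - u A`. -/
def deltaOp : L2 V →L[ℂ] L2 V :=
  (1 + q * u ^ 2) • (1 : L2 V →L[ℂ] L2 V) - u • adjOp G (fun v => (hreg v).le)

/-- The zeta function `Z_{X,Γ}`, extended to `Ω` by the determinant formula. -/
def zeta : ℂ := (1 - u ^ 2) ^ (eulerChar G Γ : ℂ) * (detΓ G Γ (deltaOp G hreg u))⁻¹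

def completedΛ : ℂ :=
  (1 - u ^ 2) ^ (-(eulerChar G Γ : ℂ)) * (1 - u ^ 2) ^ ((cardVB G Γ : ℂ) / 2) *
    (1 - q ^ 2 * u ^ 2) ^ ((cardVB G Γ : ℂ) / 2) * zeta G hreg Γ u

def completedξ : ℂ :=
  (1 - u ^ 2) ^ (-(eulerChar G Γ : ℂ)) * (1 - u) ^ cardVB G Γ * (1 - q * u) ^ cardVB G Γ *
    zeta G hreg Γ u

def completedΞ : ℂ :=
  (1 - u ^ 2) ^ (-(eulerChar G Γ : ℂ)) * (1 + q * u ^ 2) ^ cardVB G Γ * zeta G hreg Γ u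

end completed

end IharaPeriodic

end

/-!
The spectrum of `A` lies in `[-(q + 1), q + 1]`. Since `Δ(u) = q u² Δ(1 / (q u))` and
`det_Γ (c T) = c ^ |VB| det_Γ T`, the three functional equations reduce to identities between the
elementary factors.

For `‖u‖ < 1 / q`, factor `1 + q u² - u t = (1 - α u) (1 - β u)` with `α + β = t` and `α β = q`.
Then `log det_Γ Δ(u) = - ∑ uᵐ / m Tr_Γ (αᵐ + βᵐ)`, where `αᵐ + βᵐ` is a Dickson polynomial in the
adjacency operator. Its trace counts the `Γ`-orbits of reduced closed paths of length `m`, up to the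
term `(q - 1) |VB|` for even `m`, which is responsible for the power of `1 - u²`. Every reduced
closed path is a multiple of a unique prime cycle and, the action being free, the class of `C`
accounts for `|C| / |Γ_C|` orbits in each length divisible by `|C|`. Hence it contributes
`-log (1 - u ^ |C|) / |Γ_C|` to the logarithm of the zeta function.
-/

namespace IharaPeriodic

open ClosedPath Complex Function Metric MulAction Polynomial Set

/-! ### Logarithms and determinants of operators -/

section CauchyFormula

variable {𝒜 : Type*} [CStarAlgebra 𝒜] {T : 𝒜} {c : ℂ} {r : ℝ}

theorem resolvent_eq_cfc (hT : IsStarNormal T) {z : ℂ} (hz : z ∉ spectrum ℂ T) :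
    resolvent T z = cfc (fun w => (z - w)⁻¹) T := by
  rw [cfc_inv (fun w => z - w) T (fun w hw h => hz (by rwa [sub_eq_zero.1 h])),
    cfc_sub (fun _ => z) (fun w => w) T, cfc_const z T, cfc_id' ℂ T, resolvent]

theorem cfc_circleIntegral (hT : IsStarNormal T) (hr : 0 ≤ r) {F : ℂ → ℂ → ℂ}
    (hF : ContinuousOn (Function.uncurry F) (sphere c r ×ˢ spectrum ℂ T)) :
    cfc (fun w => ∮ z in C(c, r), F z w) T = ∮ z in C(c, r), cfc (F z) T := by
  have hcircle : ∀ θ, circleMap c r θ ∈ sphere c r := circleMap_mem_sphere c hr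
  have hcont : ContinuousOn (Function.uncurry fun (θ : ℝ) (w : ℂ) =>
      deriv (circleMap c r) θ • F (circleMap c r θ) w) (univ ×ˢ spectrum ℂ T) := by
    have hF' : ContinuousOn (fun p : ℝ × ℂ => F (circleMap c r p.1) p.2)
        (univ ×ˢ spectrum ℂ T) :=
      hF.comp (f := fun p : ℝ × ℂ => (circleMap c r p.1, p.2)) (by fun_prop)
        fun p hp => ⟨hcircle _, hp.2⟩
    simp only [deriv_circleMap]
    exact ContinuousOn.smul (f := fun p : ℝ × ℂ => circleMap 0 r p.1 * I) (by fun_prop) hF'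
  obtain ⟨M, hM⟩ := ((isCompact_Icc (a := (0 : ℝ)) (b := 2 * Real.pi)).prod
    (spectrum.isCompact (𝕜 := ℂ) T)).exists_bound_of_continuousOn
      (hcont.mono (prod_mono (subset_univ _) subset_rfl))
  simp only [circleIntegral, intervalIntegral.integral_of_le Real.two_pi_pos.le]
  rw [cfc_setIntegral measurableSet_Ioc _ (fun _ => M) T
    (hcont.mono (prod_mono (subset_univ _) subset_rfl))
    ((MeasureTheory.ae_restrict_mem measurableSet_Ioc).mono fun θ hθ w hw =>
      hM (θ, w) ⟨Ioc_subset_Icc_self hθ, hw⟩) (MeasureTheory.hasFiniteIntegral_const M) hT]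
  congr! 2 with θ
  exact cfc_smul _ _ T
    (hF.comp (f := fun w => (circleMap c r θ, w)) (by fun_prop) fun w hw => ⟨hcircle θ, hw⟩)

theorem circleIntegral_smul_resolvent_eq_cfc (hT : IsStarNormal T) (hr : 0 ≤ r)
    (hσ : spectrum ℂ T ⊆ ball c r) {f : ℂ → ℂ} (hf : DifferentiableOn ℂ f (closedBall c r)) :
    (2 * Real.pi * I : ℂ)⁻¹ • ∮ z in C(c, r), f z • resolvent T z = cfc f T := by
  have hfσ : ContinuousOn f (spectrum ℂ T) :=
    hf.continuousOn.mono (hσ.trans ball_subset_closedBall)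
  have hne : ∀ z ∈ sphere c r, ∀ w ∈ spectrum ℂ T, z - w ≠ 0 := fun z hz w hw h =>
    (mem_ball.1 (hσ hw)).ne (sub_eq_zero.1 h ▸ hz)
  have hintegrand : ∀ z ∈ sphere c r,
      f z • resolvent T z = cfc (fun w => f z * (z - w)⁻¹) T := fun z hz => by
    rw [resolvent_eq_cfc hT fun h => hne z hz z h (sub_self z),
      cfc_const_mul _ (fun w => (z - w)⁻¹) T (ContinuousOn.inv₀ (by fun_prop) (hne z hz))]
  have hcauchy : ∀ w ∈ spectrum ℂ T,
      ∮ z in C(c, r), f z * (z - w)⁻¹ = 2 * Real.pi * I * f w := fun w hw => by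
    simpa only [smul_eq_mul, mul_comm (_ - w)⁻¹] using
      hf.circleIntegral_sub_inv_smul (hσ hw)
  have hcont : ContinuousOn (Function.uncurry fun z w => f z * (z - w)⁻¹)
      (sphere c r ×ˢ spectrum ℂ T) :=
    ((hf.continuousOn.mono sphere_subset_closedBall).comp continuousOn_fst fun p hp => hp.1).mul
      (ContinuousOn.inv₀ (by fun_prop) fun p hp => hne p.1 hp.1 p.2 hp.2)
  rw [circleIntegral.integral_congr hr hintegrand, ← cfc_circleIntegral hT hr hcont,
    cfc_congr hcauchy, cfc_const_mul _ _ T hfσ, inv_smul_smul₀ two_pi_I_ne_zero]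

end CauchyFormula

section Logarithm

/-- The branch of the logarithm on the disc `|w - c| < |c|` that enters `logOnDisc`. -/
noncomputable def logBranch (c w : ℂ) : ℂ := log c + log (w / c)

variable {c w : ℂ}

theorem div_mem_slitPlane (h : dist w c < ‖c‖) : w / c ∈ slitPlane := by
  have hc : 0 < ‖c‖ := dist_nonneg.trans_lt h
  have hnorm : ‖w / c - 1‖ < 1 := by
    rwa [div_sub_one (norm_pos_iff.1 hc), norm_div, div_lt_one hc, ← dist_eq_norm]
  simpa only [add_sub_cancel] using mem_slitPlane_of_norm_lt_one hnorm

theorem differentiableAt_logBranch (h : dist w c < ‖c‖) : DifferentiableAt ℂ (logBranch c) w :=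
  ((differentiableAt_id.div_const c).clog (div_mem_slitPlane h)).const_add _

theorem exp_logBranch (h : dist w c < ‖c‖) : exp (logBranch c w) = w := by
  have hc : c ≠ 0 := norm_pos_iff.1 (dist_nonneg.trans_lt h)
  rw [logBranch, exp_add, exp_log hc, exp_log (slitPlane_ne_zero (div_mem_slitPlane h)),
    mul_div_cancel₀ _ hc]

theorem exists_int_of_exp_eq_one {X : Type*} [TopologicalSpace X] {S : Set X}
    (hS : IsPreconnected S) {h : X → ℂ} (hc : ContinuousOn h S) (hexp : ∀ x ∈ S, exp (h x) = 1) :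
    ∃ n : ℤ, ∀ x ∈ S, h x = n * (2 * Real.pi * I) := by
  have him : ∀ n : ℤ, (n * (2 * Real.pi * I) : ℂ).im / (2 * Real.pi) = n := fun n => by simp
  have hmem : ∀ x ∈ S, ∃ n : ℤ, h x = n * (2 * Real.pi * I) := fun x hx =>
    exp_eq_one_iff.1 (hexp x hx)
  have hdiscrete : IsDiscrete (range ((↑) : ℤ → ℝ)) :=
    ⟨Int.isClosedEmbedding_coe_real.isEmbedding.toHomeomorph.symm.isEmbedding.discreteTopology⟩
  obtain ⟨_, ⟨n, rfl⟩, hn⟩ := hS.eqOn_const_of_mapsTo hdiscrete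
    (f := fun x => (h x).im / (2 * Real.pi))
    ((continuous_im.comp_continuousOn hc).div_const _)
    (fun x hx => by
      obtain ⟨n, hn⟩ := hmem x hx
      exact ⟨n, by simp only [hn, him]⟩) (range_nonempty _)
  refine ⟨n, fun x hx => ?_⟩
  obtain ⟨m, hm⟩ := hmem x hx
  have hmn := hn hx
  simp only [hm, him, Function.const_apply, Int.cast_inj] at hmn
  rw [hm, hmn]

end Logarithm

section Trace

variable {V : Type*} (G : SimpleGraph V) (Γ : Subgroup (G ≃g G))
  [Finite (MulAction.orbitRel.Quotient Γ V)]

open Classical in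
/-- The trace `Tr_Γ` as a continuous linear functional on the bounded operators. -/
noncomputable def traceCLM : (L2 V →L[ℂ] L2 V) →L[ℂ] ℂ :=
  letI := Fintype.ofFinite (MulAction.orbitRel.Quotient Γ V)
  ∑ o : MulAction.orbitRel.Quotient Γ V,
    (innerSL ℂ (lp.single 2 (Quotient.out o) 1 : L2 V)).comp
      (ContinuousLinearMap.apply ℂ (L2 V) (lp.single 2 (Quotient.out o) 1 : L2 V))

theorem traceCLM_apply (T : L2 V →L[ℂ] L2 V) : traceCLM G Γ T = traceΓ G Γ T := by
  classical
  let _ := Fintype.ofFinite (MulAction.orbitRel.Quotient Γ V)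
  rw [traceΓ, finsum_eq_sum_of_fintype, traceCLM, sum_apply]
  refine Finset.sum_congr rfl fun o _ => ?_
  simp only [ContinuousLinearMap.comp_apply, ContinuousLinearMap.apply_apply, innerSL_apply_apply]
  rw [lp.inner_single_left]
  simp

theorem traceCLM_algebraMap (z : ℂ) :
    traceCLM G Γ (algebraMap ℂ (L2 V →L[ℂ] L2 V) z) = z * cardVB G Γ := by
  classical
  let _ := Fintype.ofFinite (MulAction.orbitRel.Quotient Γ V)
  rw [Algebra.algebraMap_eq_smul_one, map_smul, traceCLM_apply, traceΓ, finsum_eq_sum_of_fintype]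
  simp [cardVB, Nat.card_eq_fintype_card]

end Trace

section Determinant

theorem convexHull_spectrum_cfc {𝒜 : Type*} [CStarAlgebra 𝒜] {A : 𝒜} (hA : IsStarNormal A)
    (f : ℂ →ᵃ[ℝ] ℂ) :
    convexHull ℝ (spectrum ℂ (cfc f A)) = f '' convexHull ℝ (spectrum ℂ A) := by
  rw [cfc_map_spectrum f A hA f.continuous_of_finiteDimensional.continuousOn, f.image_convexHull]

variable {V : Type*} {A T : L2 V →L[ℂ] L2 V}

theorem inDetDomain_cfc_iff (hA : IsStarNormal A) (f : ℂ →ᵃ[ℝ] ℂ) :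
    InDetDomain (cfc f A) ↔ ∀ t ∈ convexHull ℝ (spectrum ℂ A), f t ≠ 0 := by
  rw [InDetDomain, convexHull_spectrum_cfc hA f]
  simp only [mem_image, not_exists, not_and, ne_eq]

theorem cfc_logBranch_cfc_eq (hA : IsStarNormal A) (f : ℂ →ᵃ[ℝ] ℂ) {c : ℂ}
    (hc : ∀ t ∈ convexHull ℝ (spectrum ℂ A), dist (f t) c < ‖c‖) {g : ℂ → ℂ}
    (hg : ContinuousOn g (convexHull ℝ (spectrum ℂ A)))
    (hexp : ∀ t ∈ convexHull ℝ (spectrum ℂ A), exp (g t) = f t) :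
    ∃ n : ℤ, cfc (logBranch c) (cfc f A) = cfc g A + algebraMap ℂ _ (n * (2 * Real.pi * I)) := by
  have hf : Continuous f := f.continuous_of_finiteDimensional
  have hσ := subset_convexHull ℝ (spectrum ℂ A)
  have hlog : ContinuousOn (fun t => logBranch c (f t)) (convexHull ℝ (spectrum ℂ A)) :=
    fun t ht => ((differentiableAt_logBranch (hc t ht)).continuousAt.comp
      hf.continuousAt).continuousWithinAt
  obtain ⟨n, hn⟩ := exists_int_of_exp_eq_one (convex_convexHull ℝ (spectrum ℂ A)).isPreconnected
    (hlog.sub hg) fun t ht => by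
      rw [Pi.sub_apply, exp_sub, exp_logBranch (hc t ht), hexp t ht,
        div_self (hexp t ht ▸ exp_ne_zero _)]
  have himage : ContinuousOn (logBranch c) (f '' spectrum ℂ A) := by
    rintro _ ⟨t, ht, rfl⟩
    exact (differentiableAt_logBranch (hc t (hσ ht))).continuousAt.continuousWithinAt
  refine ⟨n, ?_⟩
  rw [← cfc_comp' (logBranch c) f A himage, ← cfc_add_const _ _ _ (hg.mono hσ)]
  exact cfc_congr fun t ht => eq_add_of_sub_eq' (hn t (hσ ht))

variable (G : SimpleGraph V) (Γ : Subgroup (G ≃g G))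
  [Finite (MulAction.orbitRel.Quotient Γ V)]

/- The logarithm of an operator depends on the branch, but two branches differ by `2πi n` on the
connected set `conv σ(A)`, which changes the trace by an integral multiple of `2πi`. -/
theorem detΓ_cfc (hA : IsStarNormal A) (f : ℂ →ᵃ[ℝ] ℂ) {g : ℂ → ℂ}
    (hg : ContinuousOn g (convexHull ℝ (spectrum ℂ A)))
    (hexp : ∀ t ∈ convexHull ℝ (spectrum ℂ A), exp (g t) = f t) :
    detΓ G Γ (cfc f A) = exp (traceCLM G Γ (cfc g A)) := by
  have h : InDetDomain (cfc f A) :=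
    (inDetDomain_cfc_iff hA f).2 fun t ht => hexp t ht ▸ exp_ne_zero _
  rw [detΓ, dif_pos h]
  obtain ⟨hball, hr, hrc⟩ := h.exists_disc.choose_spec
  set D := h.exists_disc.choose
  have hdist : ∀ t ∈ convexHull ℝ (spectrum ℂ A), dist (f t) D.1 < ‖D.1‖ := fun t ht =>
    (mem_ball.1 (hball (convexHull_spectrum_cfc hA f ▸ mem_image_of_mem f ht))).trans hrc
  have hlog : logOnDisc (cfc f A) D.1 D.2 = cfc (logBranch D.1) (cfc f A) :=
    circleIntegral_smul_resolvent_eq_cfc (cfc_predicate f A) hr.le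
      ((subset_convexHull ℝ _).trans hball) fun z hz =>
        (differentiableAt_logBranch (lt_of_le_of_lt hz hrc)).differentiableWithinAt
  obtain ⟨n, hn⟩ := cfc_logBranch_cfc_eq hA f hdist hg hexp
  rw [hlog, hn, ← traceCLM_apply, map_add, traceCLM_algebraMap, exp_add,
    show (n * (2 * Real.pi * I) * cardVB G Γ : ℂ) = (n * cardVB G Γ : ℤ) * (2 * Real.pi * I) by
      push_cast; ring, exp_int_mul_two_pi_mul_I, mul_one]

theorem detΓ_smul (hT : IsStarNormal T) (h : InDetDomain T) {k : ℂ} (hk : k ≠ 0) :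
    detΓ G Γ (k • T) = k ^ cardVB G Γ * detΓ G Γ T := by
  obtain ⟨⟨c, r⟩, hball, -, hrc⟩ := h.exists_disc
  have hdist : ∀ t ∈ convexHull ℝ (spectrum ℂ T), dist t c < ‖c‖ := fun t ht =>
    (mem_ball.1 (hball ht)).trans hrc
  have hlog : ContinuousOn (logBranch c) (convexHull ℝ (spectrum ℂ T)) := fun t ht =>
    (differentiableAt_logBranch (hdist t ht)).continuousAt.continuousWithinAt
  have hdet := detΓ_cfc G Γ hT (AffineMap.id ℝ ℂ) hlog fun t ht => exp_logBranch (hdist t ht)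
  have hdet_smul := detΓ_cfc G Γ hT (LinearMap.mulLeft ℝ k).toAffineMap
    (g := fun t => log k + logBranch c t) (continuousOn_const.add hlog) fun t ht => by
      rw [exp_add, exp_log hk, exp_logBranch (hdist t ht)]
      rfl
  rw [show cfc (AffineMap.id ℝ ℂ) T = T from cfc_id ℂ T hT] at hdet
  rw [show cfc (LinearMap.mulLeft ℝ k).toAffineMap T = k • T from cfc_const_mul_id k T hT,
    cfc_const_add _ _ _ (hlog.mono (subset_convexHull ℝ _)), map_add, traceCLM_algebraMap, exp_add,
    mul_comm (log k), exp_nat_mul, exp_log hk] at hdet_smul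
  rw [hdet_smul, hdet]

end Determinant

/-! ### Functional equations -/

section AdjacencySpectrum

variable {V : Type*} (G : SimpleGraph V) [G.LocallyFinite] {d : ℕ} (hd : ∀ v, G.degree v ≤ d)

theorem adjOp_apply (f : L2 V) (x : V) : adjOp G hd f x = ∑ y ∈ G.neighborFinset x, f y := rfl

theorem norm_adjOp_le : ‖adjOp G hd‖ ≤ d :=
  LinearMap.mkContinuous_norm_le _ (by positivity) _

open Classical in
theorem adjOp_single (x : V) :
    adjOp G hd (lp.single 2 x 1) = ∑ y ∈ G.neighborFinset x, (lp.single 2 y 1 : L2 V) := by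
  ext y
  rw [adjOp_apply, lp.coeFn_sum, Finset.sum_apply]
  simp [Pi.single_apply, G.adj_comm]

theorem isSelfAdjoint_adjOp : IsSelfAdjoint (adjOp G hd) := by
  classical
  rw [ContinuousLinearMap.isSelfAdjoint_iff']
  ext f x
  have h := lp.inner_single_left (𝕜 := ℂ) x (1 : ℂ)
    (ContinuousLinearMap.adjoint (adjOp G hd) f)
  rw [ContinuousLinearMap.adjoint_inner_right, adjOp_single, sum_inner] at h
  simp only [lp.inner_single_left] at h
  simpa [adjOp_apply] using h.symm

theorem convexHull_spectrum_adjOp_subset :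
    convexHull ℝ (spectrum ℂ (adjOp G hd)) ⊆ {z : ℂ | z.im = 0 ∧ |z.re| ≤ d} := by
  refine convexHull_min (fun z hz => ⟨?_, ?_⟩) ?_
  · rw [(isSelfAdjoint_adjOp G hd).mem_spectrum_eq_re hz, ofReal_im]
  · calc |z.re| ≤ ‖z‖ := abs_re_le_norm z
      _ ≤ ‖adjOp G hd‖ * ‖(1 : L2 V →L[ℂ] L2 V)‖ := spectrum.norm_le_norm_mul_of_mem hz
      _ ≤ d * 1 := by
        gcongr
        exacts [norm_adjOp_le G hd, ContinuousLinearMap.norm_id_le]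
      _ = d := mul_one _
  · have hsegment : {z : ℂ | z.im = 0 ∧ |z.re| ≤ d}
        = imLm ⁻¹' {0} ∩ reLm ⁻¹' Icc (-(d : ℝ)) d := by
      ext z
      simp [abs_le]
    rw [hsegment]
    exact ((convex_singleton (0 : ℝ)).linear_preimage _).inter ((convex_Icc _ _).linear_preimage _)

end AdjacencySpectrum

section Omega

variable {q : ℕ} {u : ℂ}

theorem mem_Omega_iff :
    u ∈ Omega q ↔ ‖u‖ ^ 2 ≠ 1 / q ∧ ¬ (u.im = 0 ∧ 1 / (q : ℝ) ≤ ‖u‖ ∧ ‖u‖ ≤ 1) := by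
  rw [Complex.sq_norm, normSq_apply, ← pow_two, ← pow_two]
  refine and_congr_right' (not_congr (and_congr_right fun him => ?_))
  rw [abs_re_eq_norm.2 him]

theorem one_add_mul_sq_sub_mul_ne_zero (hq : 1 ≤ q) (hu : u ∈ Omega q) {t : ℂ} (ht : t.im = 0)
    (ht' : |t.re| ≤ q + 1) : 1 + q * u ^ 2 - u * t ≠ 0 := by
  intro h
  have hq1 : (1 : ℝ) ≤ q := by exact_mod_cast hq
  have hre := congrArg re h
  have him := congrArg im h
  simp only [pow_two, sub_re, add_re, one_re, mul_re, natCast_re, natCast_im, mul_im, ht, zero_re,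
    sub_im, add_im, one_im, zero_im] at hre him
  have hfactor : u.im * (2 * q * u.re - t.re) = 0 := by linarith
  rcases mul_eq_zero.1 hfactor with him0 | htre
  · have hle : 1 + q * |u.re| ^ 2 ≤ |u.re| * (q + 1) := by
      rw [him0] at hre
      calc 1 + q * |u.re| ^ 2 = u.re * t.re := by rw [sq_abs]; linarith
        _ ≤ |u.re| * |t.re| := abs_mul u.re t.re ▸ le_abs_self _
        _ ≤ |u.re| * (q + 1) := by gcongr
    have hprod : (q * |u.re| - 1) * (|u.re| - 1) ≤ 0 := by linarith
    refine hu.2 ⟨him0, ?_, ?_⟩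
    · rw [div_le_iff₀ (by linarith)]
      by_contra! hlt
      nlinarith
    · by_contra! hlt
      exact hprod.not_gt (mul_pos (by nlinarith) (by linarith))
  · refine hu.1 ((eq_div_iff (by linarith)).2 ?_)
    rw [show t.re = 2 * q * u.re by linarith] at hre
    linarith

theorem mem_Omega_of_norm_lt (hq : 1 ≤ q) (hu : ‖u‖ < 1 / q) : u ∈ Omega q := by
  have hq1 : 1 / (q : ℝ) ≤ 1 := (div_le_one (by positivity)).2 (by exact_mod_cast hq)
  exact mem_Omega_iff.2 ⟨by nlinarith [norm_nonneg u], fun h => h.2.1.not_gt hu⟩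

theorem one_sub_sq_ne_zero (hq : 1 ≤ q) (hu : u ∈ Omega q) : 1 - u ^ 2 ≠ 0 := by
  have hq1 : 1 / (q : ℝ) ≤ 1 := (div_le_one (by positivity)).2 (by exact_mod_cast hq)
  intro h
  apply hu.2
  rcases mul_self_eq_one_iff.1 ((pow_two u).symm.trans (sub_eq_zero.1 h).symm) with rfl | rfl <;>
    simpa using hq1

theorem one_div_mem_Omega (hq : 1 ≤ q) (hu : u ∈ Omega q) (hu0 : u ≠ 0) :
    1 / (q * u) ∈ Omega q := by
  have hq0 : (0 : ℝ) < q := by exact_mod_cast hq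
  have hn : 0 < ‖u‖ := norm_pos_iff.2 hu0
  have hnorm : ‖1 / (q * u)‖ = 1 / (q * ‖u‖) := by simp
  have him : (1 / (q * u)).im = 0 → u.im = 0 := by
    simp [inv_im, hq0.ne', hu0]
  rw [mem_Omega_iff] at hu ⊢
  rw [hnorm]
  refine ⟨fun h => hu.1 ?_, fun ⟨h, hle, hge⟩ => hu.2 ⟨him h, ?_, ?_⟩⟩
  · field_simp at h ⊢
    linarith
  · field_simp at hge ⊢
    exact hge
  · field_simp at hle ⊢
    exact hle

end Omega

section SquareRoot

theorem cpow_half_of_nonneg {r : ℝ} (hr : 0 ≤ r) : (r : ℂ) ^ (1 / 2 : ℂ) = (√r : ℝ) := by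
  rw [Real.sqrt_eq_rpow, ofReal_cpow hr]
  simp

theorem cpow_half_of_nonpos {r : ℝ} (hr : r ≤ 0) : (r : ℂ) ^ (1 / 2 : ℂ) = I * (√(-r) : ℝ) := by
  rw [ofReal_cpow_of_nonpos hr, ← ofReal_neg, cpow_half_of_nonneg (by linarith),
    show (Real.pi : ℂ) * I * (1 / 2) = Real.pi / 2 * I by ring, exp_pi_div_two_mul_I, mul_comm]

theorem cpow_half_sq_mul {r : ℝ} (hr : 0 < r) (z : ℂ) :
    (r ^ 2 * z) ^ (1 / 2 : ℂ) = r * z ^ (1 / 2 : ℂ) := by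
  rcases eq_or_ne z 0 with rfl | hz
  · simp
  have hr0 : (r : ℂ) ≠ 0 := ofReal_ne_zero.2 hr.ne'
  rw [cpow_def_of_ne_zero (mul_ne_zero (pow_ne_zero 2 hr0) hz), ← ofReal_pow,
    log_ofReal_mul (by positivity) hz, Real.log_pow, cpow_def_of_ne_zero hz, add_mul, exp_add]
  congr 1
  rw [show ((2 : ℕ) * Real.log r : ℝ) * (1 / 2 : ℂ) = (Real.log r : ℝ) by push_cast; ring,
    ← ofReal_exp, Real.exp_log hr]

theorem arg_add_arg_one_add_one_div_mem_Ioc {p : ℂ} (hp0 : p ≠ 0)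
    (hp : p ∉ ofReal '' Ioo (-1) 0) : arg p + arg (1 + 1 / p) ∈ Ioc (-Real.pi) Real.pi := by
  have hn : 0 < normSq p := normSq_pos.2 hp0
  have him : (1 + 1 / p).im = -p.im / normSq p := by rw [one_div, add_im, one_im, inv_im, zero_add]
  rcases lt_trichotomy p.im 0 with h | h | h
  · have hpos : 0 < (1 + 1 / p).im := him ▸ div_pos (by linarith) hn
    have := arg_neg_iff.2 h
    have := neg_pi_lt_arg p
    have := arg_nonneg_iff.2 hpos.le
    have := arg_le_pi (1 + 1 / p)
    constructor <;> linarith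
  · obtain ⟨x, rfl⟩ : ∃ x : ℝ, (x : ℂ) = p := ⟨p.re, ext rfl h.symm⟩
    have hnonneg : 0 ≤ 1 + 1 / x := by
      rcases lt_or_gt_of_ne (ofReal_ne_zero.1 hp0) with hx | hx
      · have hx1 : x ≤ -1 := by
          by_contra! hlt
          exact hp ⟨x, ⟨hlt, hx⟩, rfl⟩
        have hinv : -1 ≤ 1 / x := (le_div_iff_of_neg hx).2 (by linarith)
        linarith
      · positivity
    rw [show (1 + 1 / (x : ℂ)) = (1 + 1 / x : ℝ) by push_cast; rfl, arg_ofReal_of_nonneg hnonneg,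
      add_zero]
    exact arg_mem_Ioc _
  · have hneg : (1 + 1 / p).im < 0 := him ▸ div_neg_of_neg_of_pos (by linarith) hn
    have := arg_neg_iff.2 hneg
    have := neg_pi_lt_arg (1 + 1 / p)
    have := arg_nonneg_iff.2 h.le
    have := arg_le_pi p
    constructor <;> linarith

theorem cpow_half_one_add {p : ℂ} (hp0 : p ≠ 0) (hp : p ∉ ofReal '' Ioo (-1) 0) :
    (1 + p) ^ (1 / 2 : ℂ) = p ^ (1 / 2 : ℂ) * (1 + 1 / p) ^ (1 / 2 : ℂ) := by
  have hfactor : 1 + p = p * (1 + 1 / p) := by field_simp; ring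
  rcases eq_or_ne (1 + 1 / p) 0 with h0 | h0
  · rw [hfactor, h0]
    simp
  rw [hfactor, cpow_def_of_ne_zero (mul_ne_zero hp0 h0), cpow_def_of_ne_zero hp0,
    cpow_def_of_ne_zero h0, ← exp_add, ← add_mul,
    (log_mul_eq_add_log_iff hp0 h0).2 (arg_add_arg_one_add_one_div_mem_Ioc hp0 hp)]

theorem cpow_half_one_add_of_mem {p : ℂ} (hp : p ∈ ofReal '' Ioo (-1) 0) :
    (1 + p) ^ (1 / 2 : ℂ) = -(p ^ (1 / 2 : ℂ) * (1 + 1 / p) ^ (1 / 2 : ℂ)) := by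
  obtain ⟨x, ⟨hx1, hx0⟩, rfl⟩ := hp
  have hinv : 1 + 1 / x ≤ 0 := by
    rw [← le_neg_iff_add_nonpos_left, div_le_iff_of_neg hx0]
    linarith
  rw [show 1 + (x : ℂ) = (1 + x : ℝ) by push_cast; rfl,
    show 1 + 1 / (x : ℂ) = (1 + 1 / x : ℝ) by push_cast; rfl, cpow_half_of_nonneg (by linarith),
    cpow_half_of_nonpos hx0.le, cpow_half_of_nonpos hinv]
  have hsqrt : √(1 + x) = √(-x) * √(-(1 + 1 / x)) := by
    rw [← Real.sqrt_mul (by linarith)]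
    congr 1
    field_simp [hx0.ne]
    ring
  rw [hsqrt, ofReal_mul]
  linear_combination (√(-x) * √(-(1 + 1 / x)) : ℂ) * I_sq

theorem neg_sq_mem_ofReal_Ioo_iff {u : ℂ} (hu0 : u ≠ 0) :
    -u ^ 2 ∈ ofReal '' Ioo (-1) 0 ↔ u.im = 0 ∧ ‖u‖ < 1 := by
  constructor
  · rintro ⟨x, ⟨hx1, hx0⟩, hx⟩
    have hre := congrArg re hx
    have him := congrArg im hx
    have hnorm := congrArg norm hx
    simp only [pow_two, neg_re, neg_im, mul_re, mul_im, ofReal_re, ofReal_im] at hre him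
    rw [norm_neg, norm_pow, norm_real, Real.norm_of_nonpos hx0.le] at hnorm
    refine ⟨?_, (sq_lt_one_iff₀ (norm_nonneg u)).1 (by linarith)⟩
    by_contra hne
    have hre0 : u.re = 0 := (mul_eq_zero.1 (by linarith : u.re * u.im = 0)).resolve_right hne
    rw [hre0] at hre
    nlinarith [mul_self_pos.2 hne]
  · rintro ⟨him, hnorm⟩
    obtain ⟨x, rfl⟩ : ∃ x : ℝ, (x : ℂ) = u := ⟨u.re, ext rfl him.symm⟩
    rw [norm_real, Real.norm_eq_abs, ← sq_lt_one_iff_abs_lt_one] at hnorm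
    have hx : 0 < x ^ 2 := by have := ofReal_ne_zero.1 hu0; positivity
    exact ⟨-x ^ 2, ⟨by linarith, by linarith⟩, by push_cast; rfl⟩

variable {q : ℕ} {u : ℂ}

/- With `p = -u²`, each root on the left is `± p^(1/2) (1 + 1/p)^(1/2)`, with the minus sign exactly
for `p ∈ (-1, 0)`. On `Ω` the signs for `-u²` and `-(qu)²` agree, so they cancel. -/
theorem cpow_half_mul_cpow_half_inv (hq : 1 ≤ q) (hu : u ∈ Omega q) (hu0 : u ≠ 0) :
    (1 - u ^ 2) ^ (1 / 2 : ℂ) * (1 - q ^ 2 * u ^ 2) ^ (1 / 2 : ℂ)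
      = -1 * (q * u ^ 2) * ((1 - (1 / (q * u)) ^ 2) ^ (1 / 2 : ℂ)
        * (1 - q ^ 2 * (1 / (q * u)) ^ 2) ^ (1 / 2 : ℂ)) := by
  have hqpos : (0 : ℝ) < q := by exact_mod_cast hq
  have hq0 : (q : ℂ) ≠ 0 := by exact_mod_cast hqpos.ne'
  have hqu0 : q * u ≠ 0 := mul_ne_zero hq0 hu0
  have hiff : -u ^ 2 ∈ ofReal '' Ioo (-1) 0 ↔ -(q * u) ^ 2 ∈ ofReal '' Ioo (-1) 0 := by
    have hqu1 : ‖q * u‖ < 1 ↔ ‖u‖ < 1 / q := by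
      rw [norm_mul, norm_natCast, lt_div_iff₀' hqpos]
    have hq1 : 1 / (q : ℝ) ≤ 1 := (div_le_one hqpos).2 (by exact_mod_cast hq)
    rw [neg_sq_mem_ofReal_Ioo_iff hu0, neg_sq_mem_ofReal_Ioo_iff hqu0, hqu1,
      show (q * u).im = q * u.im by simp, mul_eq_zero_iff_left hqpos.ne']
    exact and_congr_right fun him => ⟨fun h => lt_of_not_ge fun hge =>
      (mem_Omega_iff.1 hu).2 ⟨him, hge, h.le⟩, fun h => h.trans_le hq1⟩
  have hsign : (1 + -u ^ 2) ^ (1 / 2 : ℂ) * (1 + -(q * u) ^ 2) ^ (1 / 2 : ℂ)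
      = ((-u ^ 2) ^ (1 / 2 : ℂ) * (1 + 1 / -u ^ 2) ^ (1 / 2 : ℂ))
        * ((-(q * u) ^ 2) ^ (1 / 2 : ℂ) * (1 + 1 / -(q * u) ^ 2) ^ (1 / 2 : ℂ)) := by
    by_cases hmem : -u ^ 2 ∈ ofReal '' Ioo (-1) 0
    · rw [cpow_half_one_add_of_mem hmem, cpow_half_one_add_of_mem (hiff.1 hmem), neg_mul_neg]
    · rw [cpow_half_one_add (neg_ne_zero.2 (pow_ne_zero 2 hu0)) hmem,
        cpow_half_one_add (neg_ne_zero.2 (pow_ne_zero 2 hqu0)) (mt hiff.2 hmem)]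
  have hscale : (-(q * u) ^ 2) ^ (1 / 2 : ℂ) = q * (-u ^ 2) ^ (1 / 2 : ℂ) := by
    rw [← ofReal_natCast, ← cpow_half_sq_mul hqpos]
    congr 1
    ring
  have hsq : ((-u ^ 2) ^ (1 / 2 : ℂ)) ^ 2 = -u ^ 2 := by simp
  rw [show 1 - u ^ 2 = 1 + -u ^ 2 by ring, show 1 - q ^ 2 * u ^ 2 = 1 + -(q * u) ^ 2 by ring, hsign,
    hscale, show 1 - (1 / (q * u)) ^ 2 = 1 + 1 / -(q * u) ^ 2 by field_simp; ring,
    show 1 - q ^ 2 * (1 / (q * u)) ^ 2 = 1 + 1 / -u ^ 2 by field_simp; ring]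
  linear_combination (q : ℂ) * (1 + 1 / -u ^ 2) ^ (1 / 2 : ℂ)
    * (1 + 1 / -(q * u) ^ 2) ^ (1 / 2 : ℂ) * hsq

end SquareRoot

section FunctionalEquations

/-- The real-affine function `t ↦ 1 + q u² - u t`, whose value at the adjacency operator is `Δ(u)`.
It is real-affine, rather than complex-affine, so that it commutes with `convexHull ℝ`. -/
noncomputable def deltaAffine (q : ℕ) (u : ℂ) : ℂ →ᵃ[ℝ] ℂ :=
  AffineMap.const ℝ ℂ (1 + q * u ^ 2) - (LinearMap.mulLeft ℝ u).toAffineMap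

variable {V : Type*} (G : SimpleGraph V) [G.LocallyFinite] {q : ℕ}
  (hreg : G.IsRegularOfDegree (q + 1)) {u : ℂ}

theorem convexHull_spectrum_adjOp_subset_of_isRegularOfDegree {t : ℂ}
    (ht : t ∈ convexHull ℝ (spectrum ℂ (adjOp G fun v => (hreg v).le))) :
    t.im = 0 ∧ |t.re| ≤ q + 1 := by
  exact_mod_cast convexHull_spectrum_adjOp_subset G _ ht

theorem deltaOp_eq_cfc (u : ℂ) :
    deltaOp G hreg u = cfc (deltaAffine q u) (adjOp G fun v => (hreg v).le) := by
  have hA := (isSelfAdjoint_adjOp G fun v => (hreg v).le).isStarNormal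
  rw [show ⇑(deltaAffine q u) = fun t => (1 + q * u ^ 2) - u * t from rfl, cfc_sub _ _ _,
    cfc_const _ _ hA, cfc_const_mul_id _ _ hA, deltaOp, Algebra.algebraMap_eq_smul_one]

theorem isStarNormal_deltaOp (u : ℂ) : IsStarNormal (deltaOp G hreg u) :=
  deltaOp_eq_cfc G hreg u ▸ cfc_predicate _ _

theorem inDetDomain_deltaOp (hq : 1 ≤ q) (hu : u ∈ Omega q) : InDetDomain (deltaOp G hreg u) := by
  rw [deltaOp_eq_cfc, inDetDomain_cfc_iff (isSelfAdjoint_adjOp G _).isStarNormal]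
  intro t ht
  obtain ⟨him, hre⟩ := convexHull_spectrum_adjOp_subset_of_isRegularOfDegree G hreg ht
  exact one_add_mul_sq_sub_mul_ne_zero hq hu him hre

theorem deltaOp_eq_smul_deltaOp_inv (hq : q ≠ 0) (hu0 : u ≠ 0) :
    deltaOp G hreg u = (q * u ^ 2 : ℂ) • deltaOp G hreg (1 / (q * u)) := by
  have hq0 : (q : ℂ) ≠ 0 := Nat.cast_ne_zero.2 hq
  rw [deltaOp, deltaOp, smul_sub, smul_smul, smul_smul]
  congr 2
  · field_simp
    ring
  · field_simp

variable (Γ : Subgroup (G ≃g G))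

theorem cpow_neg_mul_zeta (hq : 1 ≤ q) (hu : u ∈ Omega q) :
    (1 - u ^ 2) ^ (-(eulerChar G Γ : ℂ)) * zeta G hreg Γ u = (detΓ G Γ (deltaOp G hreg u))⁻¹ := by
  rw [zeta, ← mul_assoc, ← cpow_add _ _ (one_sub_sq_ne_zero hq hu), neg_add_cancel, cpow_zero,
    one_mul]

theorem completedΛ_eq (hq : 1 ≤ q) (hu : u ∈ Omega q) :
    completedΛ G hreg Γ u
      = ((1 - u ^ 2) ^ (1 / 2 : ℂ) * (1 - q ^ 2 * u ^ 2) ^ (1 / 2 : ℂ)) ^ cardVB G Γ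
        * (detΓ G Γ (deltaOp G hreg u))⁻¹ := by
  have hpow : ∀ z : ℂ, z ^ ((cardVB G Γ : ℂ) / 2) = (z ^ (1 / 2 : ℂ)) ^ cardVB G Γ := fun z => by
    rw [← cpow_nat_mul, mul_one_div]
  rw [← cpow_neg_mul_zeta G hreg Γ hq hu, completedΛ, hpow, hpow, mul_pow]
  ring

theorem completedξ_eq (hq : 1 ≤ q) (hu : u ∈ Omega q) :
    completedξ G hreg Γ u
      = ((1 - u) * (1 - q * u)) ^ cardVB G Γ * (detΓ G Γ (deltaOp G hreg u))⁻¹ := by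
  rw [← cpow_neg_mul_zeta G hreg Γ hq hu, completedξ, mul_pow]
  ring

theorem completedΞ_eq (hq : 1 ≤ q) (hu : u ∈ Omega q) :
    completedΞ G hreg Γ u
      = (1 + q * u ^ 2) ^ cardVB G Γ * (detΓ G Γ (deltaOp G hreg u))⁻¹ := by
  rw [← cpow_neg_mul_zeta G hreg Γ hq hu, completedΞ]
  ring

variable [Finite (MulAction.orbitRel.Quotient Γ V)]

/- Each completed zeta function is `z(u) ^ |VB| / det_Γ Δ(u)` with `z(u) = ± q u² z(1/(qu))`, which
compensates for `Δ(u) = q u² Δ(1/(qu))`. -/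
theorem pow_mul_inv_detΓ_deltaOp (hq : 1 ≤ q) (hu : u ∈ Omega q) (hu0 : u ≠ 0) {k z w : ℂ}
    (hzw : z = k * (q * u ^ 2) * w) :
    z ^ cardVB G Γ * (detΓ G Γ (deltaOp G hreg u))⁻¹
      = k ^ cardVB G Γ * (w ^ cardVB G Γ * (detΓ G Γ (deltaOp G hreg (1 / (q * u))))⁻¹) := by
  have hq0 : q ≠ 0 := by omega
  have hqu0 : (q * u ^ 2 : ℂ) ≠ 0 := mul_ne_zero (Nat.cast_ne_zero.2 hq0) (pow_ne_zero 2 hu0)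
  rw [hzw, deltaOp_eq_smul_deltaOp_inv G hreg hq0 hu0, detΓ_smul G Γ (isStarNormal_deltaOp G hreg _)
    (inDetDomain_deltaOp G hreg hq (one_div_mem_Omega hq hu hu0)) hqu0, mul_pow,
    mul_pow]
  field_simp

theorem completedΛ_functional_equation (hq : 1 ≤ q) (hu : u ∈ Omega q) (hu0 : u ≠ 0) :
    completedΛ G hreg Γ u = (-1) ^ cardVB G Γ * completedΛ G hreg Γ (1 / (q * u)) := by
  rw [completedΛ_eq G hreg Γ hq hu, completedΛ_eq G hreg Γ hq (one_div_mem_Omega hq hu hu0)]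
  exact pow_mul_inv_detΓ_deltaOp G hreg Γ hq hu hu0 (cpow_half_mul_cpow_half_inv hq hu hu0)

theorem completedξ_functional_equation (hq : 1 ≤ q) (hu : u ∈ Omega q) (hu0 : u ≠ 0) :
    completedξ G hreg Γ u = completedξ G hreg Γ (1 / (q * u)) := by
  have hq0 : (q : ℂ) ≠ 0 := Nat.cast_ne_zero.2 (by omega)
  rw [completedξ_eq G hreg Γ hq hu, completedξ_eq G hreg Γ hq (one_div_mem_Omega hq hu hu0),
    pow_mul_inv_detΓ_deltaOp G hreg Γ hq hu hu0 (k := 1)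
      (w := (1 - 1 / (q * u)) * (1 - q * (1 / (q * u)))) (by field_simp; ring), one_pow, one_mul]

theorem completedΞ_functional_equation (hq : 1 ≤ q) (hu : u ∈ Omega q) (hu0 : u ≠ 0) :
    completedΞ G hreg Γ u = completedΞ G hreg Γ (1 / (q * u)) := by
  have hq0 : (q : ℂ) ≠ 0 := Nat.cast_ne_zero.2 (by omega)
  rw [completedΞ_eq G hreg Γ hq hu, completedΞ_eq G hreg Γ hq (one_div_mem_Omega hq hu hu0),
    pow_mul_inv_detΓ_deltaOp G hreg Γ hq hu hu0 (k := 1)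
      (w := 1 + q * (1 / (q * u)) ^ 2) (by field_simp; ring), one_pow, one_mul]

end FunctionalEquations

/-! ### Traces of powers and Dickson polynomials -/

section Dickson

theorem eval_dickson_one_mul_add {R : Type*} [CommRing R] (α β : R) (m : ℕ) :
    (dickson 1 (α * β) m).eval (α + β) = α ^ m + β ^ m := by
  induction m using Nat.twoStepInduction with
  | zero => norm_num [dickson_zero]
  | one => simp
  | more m ih₁ ih₂ =>
    rw [dickson_add_two, eval_sub, eval_mul, eval_mul, ih₁, ih₂, eval_X, eval_C]
    ring

theorem exists_add_eq_mul_eq {K : Type*} [Field K] [IsAlgClosed K] [NeZero (2 : K)] (s p : K) :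
    ∃ α β : K, α + β = s ∧ α * β = p := by
  obtain ⟨r, hr⟩ := IsAlgClosed.exists_pow_nat_eq (s ^ 2 - 4 * p) two_pos
  have h2 : (2 : K) ≠ 0 := two_ne_zero
  refine ⟨(s + r) / 2, (s - r) / 2, by field_simp; ring, ?_⟩
  field_simp
  linear_combination -hr

variable {q : ℕ} {t u : ℂ}

theorem norm_le_of_add_eq_of_mul_eq (hq : 1 ≤ q) (ht : t.im = 0) (ht' : |t.re| ≤ q + 1) {α β : ℂ}
    (hadd : α + β = t) (hmul : α * β = q) : ‖α‖ ≤ q := by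
  by_contra! hlt
  have hq0 : (0 : ℝ) < q := by exact_mod_cast hq
  have hα : α ≠ 0 := norm_pos_iff.1 (hq0.trans hlt)
  have hinv : ‖α⁻¹‖ < 1 / q := by
    rw [norm_inv, one_div]
    exact inv_strictAnti₀ hq0 hlt
  refine one_add_mul_sq_sub_mul_ne_zero hq (mem_Omega_of_norm_lt hq hinv) ht ht' ?_
  rw [← hadd, ← hmul]
  field_simp
  ring

theorem exists_add_eq_mul_eq_norm_le (hq : 1 ≤ q) (ht : t.im = 0) (ht' : |t.re| ≤ q + 1) :
    ∃ α β : ℂ, α + β = t ∧ α * β = q ∧ ‖α‖ ≤ q ∧ ‖β‖ ≤ q := by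
  obtain ⟨α, β, hadd, hmul⟩ := exists_add_eq_mul_eq t q
  exact ⟨α, β, hadd, hmul, norm_le_of_add_eq_of_mul_eq hq ht ht' hadd hmul,
    norm_le_of_add_eq_of_mul_eq hq ht ht' ((add_comm β α).trans hadd) ((mul_comm β α).trans hmul)⟩

theorem norm_pow_div_mul_eval_dickson_le (hq : 1 ≤ q) (ht : t.im = 0) (ht' : |t.re| ≤ q + 1)
    (u : ℂ) (m : ℕ) :
    ‖u ^ m / m * (dickson 1 (q : ℂ) m).eval t‖ ≤ 2 * (‖u‖ * q) ^ m := by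
  obtain ⟨α, β, rfl, hmul, hα, hβ⟩ := exists_add_eq_mul_eq_norm_le hq ht ht'
  have hdiv : ‖u ^ m / (m : ℂ)‖ ≤ ‖u‖ ^ m := by
    rw [norm_div, norm_pow, norm_natCast]
    rcases m.eq_zero_or_pos with rfl | hm
    · simp
    · exact div_le_self (by positivity) (by exact_mod_cast hm)
  calc ‖u ^ m / m * (dickson 1 (q : ℂ) m).eval (α + β)‖ ≤ ‖u‖ ^ m * ‖α ^ m + β ^ m‖ := by
        rw [← hmul, eval_dickson_one_mul_add, norm_mul]
        gcongr
    _ ≤ ‖u‖ ^ m * (‖α‖ ^ m + ‖β‖ ^ m) := by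
        rw [← norm_pow α, ← norm_pow β]
        gcongr
        exact norm_add_le _ _
    _ ≤ ‖u‖ ^ m * (q ^ m + q ^ m) := by gcongr
    _ = 2 * (‖u‖ * q) ^ m := by ring

theorem exp_neg_tsum_dickson (hq : 1 ≤ q) (hu : ‖u‖ < 1 / q) (ht : t.im = 0)
    (ht' : |t.re| ≤ q + 1) :
    exp (-∑' m : ℕ, u ^ m / m * (dickson 1 (q : ℂ) m).eval t) = 1 + q * u ^ 2 - u * t := by
  obtain ⟨α, β, rfl, hmul, hα, hβ⟩ := exists_add_eq_mul_eq_norm_le hq ht ht'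
  have hlt : ∀ γ : ℂ, ‖γ‖ ≤ q → ‖u * γ‖ < 1 := fun γ hγ => by
    rw [lt_div_iff₀ (by exact_mod_cast hq)] at hu
    calc ‖u * γ‖ = ‖u‖ * ‖γ‖ := norm_mul u γ
      _ ≤ ‖u‖ * q := by gcongr
      _ < 1 := hu
  have hsum : HasSum (fun m : ℕ => u ^ m / m * (dickson 1 (q : ℂ) m).eval (α + β))
      (-log (1 - u * α) + -log (1 - u * β)) :=
    ((hasSum_taylorSeries_neg_log (hlt α hα)).add
      (hasSum_taylorSeries_neg_log (hlt β hβ))).congr_fun fun m => by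
        rw [← hmul, eval_dickson_one_mul_add]
        ring
  rw [hsum.tsum_eq, neg_add, neg_neg, neg_neg, exp_add,
    exp_log (isUnit_one_sub_of_norm_lt_one (hlt α hα)).ne_zero,
    exp_log (isUnit_one_sub_of_norm_lt_one (hlt β hβ)).ne_zero, ← hmul]
  ring

end Dickson

section PowerTrace

theorem hasSum_cfc {𝒜 ι : Type*} [CStarAlgebra 𝒜] {A : 𝒜} {f : ι → ℂ → ℂ} {b : ι → ℝ}
    (hf : ∀ i, ContinuousOn (f i) (spectrum ℂ A)) (hb : Summable b)
    (hfb : ∀ i, ∀ t ∈ spectrum ℂ A, ‖f i t‖ ≤ b i) :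
    HasSum (fun i => cfc (f i) A) (cfc (fun t => ∑' i, f i t) A) := by
  have hlim := tendsto_cfc_fun (p := IsStarNormal) (tendstoUniformlyOn_tsum hb hfb)
    (Filter.Eventually.of_forall fun s => continuousOn_finsetSum s fun i _ => hf i)
  refine hlim.congr fun s => ?_
  rw [← cfc_sum f A s fun i _ => hf i]
  congr 1
  ext t
  rw [Finset.sum_apply]

variable {V : Type*} (G : SimpleGraph V) [G.LocallyFinite] {q : ℕ}
  (hreg : G.IsRegularOfDegree (q + 1)) (Γ : Subgroup (G ≃g G))
  [Finite (MulAction.orbitRel.Quotient Γ V)] {u : ℂ}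

/-- The trace of `α ^ m + β ^ m`, where `α + β = A` and `α β = q`. This power sum is the value at
`A` of a Dickson polynomial, so no operators `α` and `β` need to be constructed. -/
noncomputable def powerTrace (m : ℕ) : ℂ :=
  traceCLM G Γ (aeval (adjOp G fun v => (hreg v).le) (dickson 1 (q : ℂ) m))

theorem hasSum_powerTrace (hq : 1 ≤ q) (hu : ‖u‖ < 1 / q) :
    HasSum (fun m : ℕ => u ^ m / m * powerTrace G hreg Γ m)
      (traceCLM G Γ (cfc (fun t => ∑' m : ℕ, u ^ m / m * (dickson 1 (q : ℂ) m).eval t)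
        (adjOp G fun v => (hreg v).le))) := by
  have hA := (isSelfAdjoint_adjOp G fun v => (hreg v).le).isStarNormal
  have hgeom : Summable fun m : ℕ => 2 * (‖u‖ * q) ^ m := by
    rw [lt_div_iff₀ (by exact_mod_cast hq)] at hu
    exact (summable_geometric_of_lt_one (by positivity) hu).mul_left 2
  have hcfc := hasSum_cfc (A := adjOp G fun v => (hreg v).le)
    (f := fun m t => u ^ m / m * (dickson 1 (q : ℂ) m).eval t) (fun m => by fun_prop) hgeom
    fun m t ht => by
      obtain ⟨him, hre⟩ := convexHull_spectrum_adjOp_subset_of_isRegularOfDegree G hreg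
        (subset_convexHull ℝ _ ht)
      exact norm_pow_div_mul_eval_dickson_le hq him hre u m
  refine ((traceCLM G Γ).hasSum hcfc).congr_fun fun m => ?_
  change _ = traceCLM G Γ _
  rw [cfc_const_mul _ _ _ (Polynomial.continuous _).continuousOn, cfc_polynomial _ _ hA, map_smul,
    smul_eq_mul, powerTrace]

theorem detΓ_deltaOp_eq_exp (hq : 1 ≤ q) (hu : ‖u‖ < 1 / q) :
    detΓ G Γ (deltaOp G hreg u) = exp (-∑' m : ℕ, u ^ m / m * powerTrace G hreg Γ m) := by
  have hK := fun t => convexHull_spectrum_adjOp_subset_of_isRegularOfDegree G hreg (t := t)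
  have hcont : ContinuousOn (fun t => ∑' m : ℕ, u ^ m / m * (dickson 1 (q : ℂ) m).eval t)
      (convexHull ℝ (spectrum ℂ (adjOp G fun v => (hreg v).le))) := by
    refine continuousOn_tsum (fun m => by fun_prop) ?_ fun m t ht =>
      norm_pow_div_mul_eval_dickson_le hq (hK t ht).1 (hK t ht).2 u m
    rw [lt_div_iff₀ (by exact_mod_cast hq)] at hu
    exact (summable_geometric_of_lt_one (by positivity) hu).mul_left 2
  rw [deltaOp_eq_cfc, detΓ_cfc G Γ (isSelfAdjoint_adjOp G _).isStarNormal _ hcont.neg fun t ht =>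
      exp_neg_tsum_dickson hq hu (hK t ht).1 (hK t ht).2,
    (hasSum_powerTrace G hreg Γ hq hu).tsum_eq]
  exact congrArg exp ((congrArg _ (cfc_neg _ _)).trans (map_neg _ _))

end PowerTrace

/-! ### Orbits and invariant kernels -/

section OrbitCounting

variable {H X Y : Type*} [Group H] [MulAction H X] [MulAction H Y]

/-- The map on orbits induced by an equivariant map. -/
def orbitMap (f : X →[H] Y) : orbitRel.Quotient H X → orbitRel.Quotient H Y :=
  Quotient.map f <| by
    rintro _ x ⟨h, rfl⟩
    exact ⟨h, (map_smul f h x).symm⟩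

theorem isCancelSMul_of_mulActionHom [IsCancelSMul H Y] (f : X →[H] Y) : IsCancelSMul H X :=
  isCancelSMul_iff_eq_one_of_smul_eq.2 fun h x hx =>
    IsCancelSMul.eq_one_of_smul (x := f x) (by rw [← map_smul, hx])

/-- The fibre of an equivariant map over `y`, with the action of the stabilizer of `y`. -/
def stabilizerFiber (f : X →[H] Y) (y : Y) : SubMulAction (stabilizer H y) X where
  carrier := {x | f x = y}
  smul_mem' h x hx := by
    change f (h.1 • x) = y
    rw [map_smul, show f x = y from hx]
    exact h.2

theorem orbitMap_mk_eq_mk_iff (f : X →[H] Y) (x : X) (y : Y) :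
    orbitMap f (Quotient.mk _ x) = Quotient.mk _ y ↔ ∃ h : H, f (h • x) = y := by
  rw [eq_comm]
  exact Quotient.eq.trans (exists_congr fun h => by rw [map_smul])

theorem card_orbits_stabilizerFiber (f : X →[H] Y) (y : Y) :
    Nat.card (orbitRel.Quotient (stabilizer H y) (stabilizerFiber f y))
      = Nat.card {o // orbitMap f o = Quotient.mk _ y} := by
  refine Nat.card_eq_of_bijective (fun o => ⟨Quotient.map Subtype.val ?_ o, ?_⟩) ⟨?_, ?_⟩
  · rintro _ x ⟨h, rfl⟩
    exact ⟨h, rfl⟩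
  · induction o using Quotient.inductionOn with
    | _ x => exact congrArg _ x.2
  · intro o o' heq
    induction o, o' using Quotient.inductionOn₂ with
    | _ x x' =>
      obtain ⟨h, hh⟩ : ∃ h : H, h • x'.1 = x.1 := Quotient.exact (congrArg Subtype.val heq)
      have hmem : h ∈ stabilizer H y := by
        have := map_smul f h x'.1
        rw [hh, x.2, x'.2] at this
        exact this.symm
      exact Quotient.sound ⟨⟨h, hmem⟩, Subtype.ext hh⟩
  · rintro ⟨o, ho⟩
    induction o using Quotient.inductionOn with
    | _ x =>
      obtain ⟨h, hh⟩ := (orbitMap_mk_eq_mk_iff f x y).1 ho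
      exact ⟨Quotient.mk _ ⟨h • x, hh⟩, Subtype.ext (Quotient.sound ⟨h, rfl⟩)⟩

theorem card_fiber_eq [IsCancelSMul H X] (f : X →[H] Y) (y : Y) :
    Nat.card {x // f x = y}
      = Nat.card {o // orbitMap f o = Quotient.mk _ y} * Nat.card (stabilizer H y) := by
  have hfree : ∀ x : stabilizerFiber f y, stabilizer (stabilizer H y) x = ⊥ := fun x =>
    (Subgroup.eq_bot_iff_forall _).2 fun h hh =>
      Subtype.ext (IsCancelSMul.eq_one_of_smul (x := x.1) (congrArg Subtype.val hh))
  let e : stabilizerFiber f y ≃ _ := selfEquivOrbitsQuotientProd hfree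
  rw [← card_orbits_stabilizerFiber, ← Nat.card_prod]
  exact Nat.card_congr e

theorem finite_orbits (f : X →[H] Y) [Finite (orbitRel.Quotient H Y)]
    (hfin : ∀ y, Finite {x // f x = y}) : Finite (orbitRel.Quotient H X) := by
  refine Finite.of_surjective
    (fun p : Σ o : orbitRel.Quotient H Y, {x // f x = o.out} =>
      (Quotient.mk _ p.2.1 : orbitRel.Quotient H X)) fun o => ?_
  induction o using Quotient.inductionOn with
  | _ x =>
    obtain ⟨h, hh⟩ := (orbitMap_mk_eq_mk_iff f x _).1 (Quotient.out_eq (orbitMap f ⟦x⟧)).symm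
    exact ⟨⟨_, h • x, hh⟩, Quotient.sound ⟨h, rfl⟩⟩

theorem card_orbits_eq_sum [IsCancelSMul H Y] (f : X →[H] Y) [Fintype (orbitRel.Quotient H Y)]
    (hfin : ∀ y, Finite {x // f x = y}) :
    Nat.card (orbitRel.Quotient H X)
      = ∑ o : orbitRel.Quotient H Y, Nat.card {x // f x = o.out} := by
  have := finite_orbits f hfin
  have := isCancelSMul_of_mulActionHom f
  have hfiber : ∀ o : orbitRel.Quotient H Y,
      Nat.card {x // f x = o.out} = Nat.card {p // orbitMap f p = o} := fun o => by
    rw [card_fiber_eq, IsCancelSMul.stabilizer_eq_bot, Subgroup.card_bot, mul_one, Quotient.out_eq]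
  simp only [hfiber]
  rw [← Nat.card_sigma]
  exact (Nat.card_congr (Equiv.sigmaFiberEquiv _)).symm

end OrbitCounting

section Quotient

variable {V : Type*} {G : SimpleGraph V} {Γ : Subgroup (G ≃g G)}

theorem isCancelSMul_of_free (hfree : ∀ γ ∈ Γ, γ ≠ 1 → ∀ v : V, γ v ≠ v) : IsCancelSMul Γ V :=
  isCancelSMul_iff_eq_one_of_smul_eq.2 fun γ v hv => by
    by_contra hne
    exact hfree γ.1 γ.2 (fun h => hne (Subtype.ext h)) v hv

variable (G Γ)

/-- The oriented edges, as pairs of adjacent vertices, with the action of `Γ`. -/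
def orientedEdges : SubMulAction Γ (V × V) where
  carrier := {p | G.Adj p.1 p.2}
  smul_mem' γ _ h := γ.1.map_adj_iff.2 h

/-- The map sending an oriented edge to its origin. -/
def edgeOrigin : orientedEdges G Γ →[Γ] V where
  toFun e := e.1.1
  map_smul' _ _ := rfl

theorem cardOrientedEB_eq_card_orbits :
    cardOrientedEB G Γ = Nat.card (orbitRel.Quotient Γ (orientedEdges G Γ)) :=
  Nat.card_congr <| Quotient.congr (Equiv.refl _) fun _ _ =>
    exists_congr fun _ => ⟨fun h => Subtype.ext h, congrArg Subtype.val⟩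

/-- The oriented edges with origin `v` correspond to the neighbours of `v`. -/
def edgeOriginFiberEquiv (v : V) : {e // edgeOrigin G Γ e = v} ≃ G.neighborSet v where
  toFun e := ⟨e.1.1.2, by
    obtain ⟨⟨_, h⟩, rfl⟩ := e
    exact h⟩
  invFun w := ⟨⟨(v, w), w.2⟩, rfl⟩
  left_inv := by
    rintro ⟨⟨⟨_, _⟩, _⟩, rfl⟩
    rfl
  right_inv _ := rfl

variable [G.LocallyFinite] [IsCancelSMul Γ V] [Finite (orbitRel.Quotient Γ V)]

theorem cardOrientedEB_eq {d : ℕ} (hreg : G.IsRegularOfDegree d) :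
    cardOrientedEB G Γ = cardVB G Γ * d := by
  let _ := Fintype.ofFinite (orbitRel.Quotient Γ V)
  have hfiber : ∀ v, Nat.card {e // edgeOrigin G Γ e = v} = d := fun v => by
    rw [Nat.card_congr (edgeOriginFiberEquiv G Γ v), Nat.card_eq_fintype_card,
      G.card_neighborSet_eq_degree, hreg v]
  rw [cardOrientedEB_eq_card_orbits, card_orbits_eq_sum (edgeOrigin G Γ)
    fun v => Finite.of_equiv _ (edgeOriginFiberEquiv G Γ v).symm]
  simp only [hfiber, Finset.sum_const, smul_eq_mul, Finset.card_univ, cardVB,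
    Nat.card_eq_fintype_card]

theorem eulerChar_eq {q : ℕ} (hreg : G.IsRegularOfDegree (q + 1)) :
    (eulerChar G Γ : ℂ) = -((q - 1) * cardVB G Γ / 2) := by
  rw [eulerChar, cardOrientedEB_eq G Γ hreg]
  push_cast
  ring

end Quotient

/-! ### Walks without backtracking -/

theorem ncard_eq_sum_ncard_fiber {X Y : Type*} {s : Set X} (hs : s.Finite) {g : X → Y}
    {t : Finset Y} (hg : Set.MapsTo g s t) : s.ncard = ∑ y ∈ t, {x ∈ s | g x = y}.ncard := by
  classical
  rw [Set.ncard_eq_toFinset_card s hs,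
    Finset.card_eq_sum_card_fiberwise (f := g) (t := t) (by simpa using hg)]
  refine Finset.sum_congr rfl fun y _ => ?_
  rw [Set.ncard_eq_toFinset_card _ (hs.subset fun x hx => hx.1)]
  congr 1
  ext x
  simp

section Walks

variable {V : Type*} (G : SimpleGraph V)

/-- A walk `w₀, …, w_m` without backtracking, as a function on `ℕ` that is constant after `m`. -/
def IsProperWalk (m : ℕ) (w : ℕ → V) : Prop :=
  (∀ i, i < m → G.Adj (w i) (w (i + 1))) ∧ (∀ i, i + 2 ≤ m → w i ≠ w (i + 2)) ∧
    ∀ i, m ≤ i → w i = w m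

/-- The walks of length `m` without backtracking from `x` to `y`. -/
def properWalks (m : ℕ) (x y : V) : Set (ℕ → V) :=
  {w | IsProperWalk G m w ∧ w 0 = x ∧ w m = y}

/-- The walks of length `m` without backtracking from a neighbour of `x` to `y`. Prolonging them
by `x` gives walks of length `m + 1`, which backtrack precisely when the second vertex is `x`. -/
def neighborWalks (m : ℕ) (x y : V) : Set (ℕ → V) :=
  {w | IsProperWalk G m w ∧ G.Adj x (w 0) ∧ w m = y}

/-- The walk `w` with the vertex `x` put in front. -/
def consWalk (x : V) (w : ℕ → V) : ℕ → V
  | 0 => x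
  | i + 1 => w i

theorem consWalk_injective (x : V) : Function.Injective (consWalk x) := fun _ _ h =>
  funext fun i => congrFun h (i + 1)

theorem consWalk_zero_succ (w : ℕ → V) : consWalk (w 0) (fun i => w (i + 1)) = w :=
  funext fun i => by cases i <;> rfl

variable {G}

theorem isProperWalk_consWalk {m : ℕ} {x : V} {w : ℕ → V} :
    IsProperWalk G (m + 1) (consWalk x w)
      ↔ IsProperWalk G m w ∧ G.Adj x (w 0) ∧ x ≠ w 1 := by
  constructor
  · rintro ⟨hadj, hne, hconst⟩
    refine ⟨⟨fun i hi => hadj (i + 1) (by omega), fun i hi => hne (i + 1) (by omega),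
      fun i hi => hconst (i + 1) (by omega)⟩, hadj 0 (by omega), ?_⟩
    rcases Nat.eq_zero_or_pos m with rfl | hm
    · rw [show w 1 = w 0 from hconst 2 (by omega)]
      exact (hadj 0 (by omega)).ne
    · exact hne 0 (by omega)
  · rintro ⟨⟨hadj, hne, hconst⟩, hx_adj, hx_ne⟩
    refine ⟨fun i hi => ?_, fun i hi => ?_, fun i hi => ?_⟩
    · cases i with
      | zero => exact hx_adj
      | succ i => exact hadj i (by omega)
    · cases i with
      | zero => exact hx_ne
      | succ i => exact hne i (by omega)
    · cases i with
      | zero => omega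
      | succ i => exact hconst i (by omega)

theorem properWalks_zero (x y : V) : properWalks G 0 x y = {w | w = (fun _ => x) ∧ x = y} := by
  ext w
  constructor
  · rintro ⟨⟨-, -, hconst⟩, rfl, rfl⟩
    exact ⟨funext fun i => hconst i (Nat.zero_le i), rfl⟩
  · rintro ⟨rfl, rfl⟩
    exact ⟨⟨fun i hi => absurd hi (Nat.not_lt_zero i), fun i hi => by omega, fun _ _ => rfl⟩,
      rfl, rfl⟩

theorem properWalks_succ (m : ℕ) (x y : V) :
    properWalks G (m + 1) x y = consWalk x '' {w ∈ neighborWalks G m x y | w 1 ≠ x} := by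
  ext w
  constructor
  · rintro ⟨hw, rfl, hy⟩
    rw [← consWalk_zero_succ w, isProperWalk_consWalk] at hw
    exact ⟨fun i => w (i + 1), ⟨⟨hw.1, hw.2.1, hy⟩, hw.2.2.symm⟩, consWalk_zero_succ w⟩
  · rintro ⟨w, ⟨⟨hw, hx_adj, hy⟩, hx_ne⟩, rfl⟩
    exact ⟨isProperWalk_consWalk.2 ⟨hw, hx_adj, hx_ne.symm⟩, rfl, hy⟩

open Classical in
theorem ncard_properWalks_zero (x y : V) :
    (properWalks G 0 x y).ncard = if x = y then 1 else 0 := by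
  rw [properWalks_zero]
  split_ifs with h <;> simp [h]

theorem setOf_neighborWalks_succ_tail_eq {m : ℕ} {x y : V} {w : ℕ → V}
    (hw : w ∈ properWalks G m x y) :
    {v ∈ {v ∈ neighborWalks G (m + 1) x y | v 1 = x} | (fun i => v (i + 1)) = w}
      = (consWalk · w) '' {z | G.Adj x z ∧ z ≠ w 1} := by
  ext v
  constructor
  · rintro ⟨⟨⟨hv, hx_adj, -⟩, -⟩, rfl⟩
    rw [← consWalk_zero_succ v, isProperWalk_consWalk] at hv
    exact ⟨v 0, ⟨hx_adj, hv.2.2⟩, consWalk_zero_succ v⟩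
  · rintro ⟨z, ⟨hz_adj, hz_ne⟩, rfl⟩
    exact ⟨⟨⟨isProperWalk_consWalk.2 ⟨hw.1, hw.2.1 ▸ hz_adj.symm, hz_ne⟩, hz_adj, hw.2.2⟩,
      hw.2.1⟩, rfl⟩

variable [G.LocallyFinite]

theorem neighborWalks_eq_biUnion (m : ℕ) (x y : V) :
    neighborWalks G m x y = ⋃ z ∈ G.neighborFinset x, properWalks G m z y := by
  ext w
  simp only [neighborWalks, properWalks, Set.mem_iUnion, Set.mem_ofPred_eq, exists_prop,
    SimpleGraph.mem_neighborFinset]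
  exact ⟨fun h => ⟨w 0, h.2.1, h.1, rfl, h.2.2⟩, fun ⟨_, hz, hw, h0, hy⟩ => ⟨hw, h0 ▸ hz, hy⟩⟩

theorem finite_properWalks (m : ℕ) (x y : V) : (properWalks G m x y).Finite := by
  induction m generalizing x with
  | zero =>
    rw [properWalks_zero]
    exact (Set.finite_singleton (fun _ : ℕ => x)).subset fun w hw => hw.1
  | succ m ih =>
    rw [properWalks_succ]
    refine Set.Finite.image _ (Set.Finite.subset ?_ (Set.sep_subset _ _))
    rw [neighborWalks_eq_biUnion]
    exact Set.Finite.biUnion (Finset.finite_toSet _) fun z _ => ih z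

theorem finite_neighborWalks (m : ℕ) (x y : V) : (neighborWalks G m x y).Finite := by
  rw [neighborWalks_eq_biUnion]
  exact Set.Finite.biUnion (Finset.finite_toSet _) fun z _ => finite_properWalks m z y

theorem ncard_neighborWalks (m : ℕ) (x y : V) :
    (neighborWalks G m x y).ncard = ∑ z ∈ G.neighborFinset x, (properWalks G m z y).ncard := by
  rw [ncard_eq_sum_ncard_fiber (finite_neighborWalks m x y) (g := fun w => w 0)
    (t := G.neighborFinset x) fun w hw => (G.mem_neighborFinset _ _).2 hw.2.1]
  refine Finset.sum_congr rfl fun z hz => congrArg Set.ncard ?_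
  ext w
  constructor
  · rintro ⟨⟨hw, -, hy⟩, h0⟩
    exact ⟨hw, h0, hy⟩
  · rintro ⟨hw, rfl, hy⟩
    exact ⟨⟨hw, (G.mem_neighborFinset _ _).1 hz, hy⟩, rfl⟩

theorem ncard_neighborWalks_eq_add (m : ℕ) (x y : V) :
    (neighborWalks G m x y).ncard
      = (properWalks G (m + 1) x y).ncard + {w ∈ neighborWalks G m x y | w 1 = x}.ncard := by
  rw [properWalks_succ, Set.ncard_image_of_injective _ (consWalk_injective x), add_comm]
  exact (Set.ncard_inter_add_ncard_sdiff_eq_ncard (neighborWalks G m x y) {w | w 1 = x}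
    (finite_neighborWalks m x y)).symm

theorem ncard_neighborWalks_zero_returning (x y : V) :
    {w ∈ neighborWalks G 0 x y | w 1 = x}.ncard = 0 := by
  rw [Set.ncard_eq_zero ((finite_neighborWalks 0 x y).subset (Set.sep_subset _ _))]
  refine Set.eq_empty_of_forall_notMem ?_
  rintro w ⟨⟨⟨-, -, hconst⟩, hx_adj, -⟩, h1⟩
  rw [← hconst 1 (by omega), h1] at hx_adj
  exact hx_adj.ne rfl

theorem ncard_neighborWalks_succ_returning {c m : ℕ} {x y : V}
    (hc : ∀ w ∈ properWalks G m x y, {z | G.Adj x z ∧ z ≠ w 1}.ncard = c) :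
    {w ∈ neighborWalks G (m + 1) x y | w 1 = x}.ncard = c * (properWalks G m x y).ncard := by
  have hfinite := (finite_neighborWalks (m + 1) x y).subset
    (Set.sep_subset (neighborWalks G (m + 1) x y) fun w => w 1 = x)
  have htail : Set.MapsTo (fun w i => w (i + 1)) {w ∈ neighborWalks G (m + 1) x y | w 1 = x}
      (finite_properWalks (G := G) m x y).toFinset := by
    rintro w ⟨⟨hw, -, hy⟩, h1⟩
    rw [← consWalk_zero_succ w, isProperWalk_consWalk] at hw
    exact Finset.mem_coe.2 ((Set.Finite.mem_toFinset _).2 ⟨hw.1, h1, hy⟩)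
  rw [ncard_eq_sum_ncard_fiber hfinite htail, Finset.sum_eq_card_nsmul (b := c) fun w hw => ?_,
    Set.ncard_eq_toFinset_card _ (finite_properWalks (G := G) m x y), smul_eq_mul, mul_comm]
  have hw' := (Set.Finite.mem_toFinset _).1 hw
  rw [setOf_neighborWalks_succ_tail_eq hw',
    Set.ncard_image_of_injective _ fun z z' h => congrFun h 0, hc w hw']

theorem ncard_properWalks_one (x y : V) :
    (properWalks G 1 x y).ncard = ∑ z ∈ G.neighborFinset x, (properWalks G 0 z y).ncard := by
  rw [← ncard_neighborWalks, ncard_neighborWalks_eq_add, ncard_neighborWalks_zero_returning,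
    add_zero]

variable {q : ℕ}

theorem ncard_setOf_adj {d : ℕ} (hreg : G.IsRegularOfDegree d) (x : V) :
    {z | G.Adj x z}.ncard = d := by
  rw [← hreg x, ← G.card_neighborSet_eq_degree, ← Nat.card_eq_fintype_card]
  rfl

theorem ncard_properWalks_two {d : ℕ} (hreg : G.IsRegularOfDegree d) (x y : V) :
    (properWalks G 2 x y).ncard + d * (properWalks G 0 x y).ncard
      = ∑ z ∈ G.neighborFinset x, (properWalks G 1 z y).ncard := by
  rw [← ncard_neighborWalks, ncard_neighborWalks_eq_add,
    ncard_neighborWalks_succ_returning (c := d)]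
  rintro w ⟨⟨-, -, hconst⟩, h0, -⟩
  rw [← ncard_setOf_adj hreg x]
  congr 1
  ext z
  simp only [Set.mem_ofPred_eq, and_iff_left_iff_imp]
  rintro hz rfl
  rw [hconst 1 (by omega), h0] at hz
  exact hz.ne rfl

theorem ncard_properWalks_add_three (hreg : G.IsRegularOfDegree (q + 1)) (m : ℕ) (x y : V) :
    (properWalks G (m + 3) x y).ncard + q * (properWalks G (m + 1) x y).ncard
      = ∑ z ∈ G.neighborFinset x, (properWalks G (m + 2) z y).ncard := by
  rw [← ncard_neighborWalks, ncard_neighborWalks_eq_add,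
    ncard_neighborWalks_succ_returning (c := q)]
  rintro w ⟨⟨hadj, -, -⟩, h0, -⟩
  have hx_adj : G.Adj x (w 1) := h0 ▸ hadj 0 (by omega)
  have hcard := Set.ncard_sdiff_singleton_of_mem (s := {z | G.Adj x z}) (a := w 1) hx_adj
  rwa [ncard_setOf_adj hreg x, Nat.add_sub_cancel] at hcard

end Walks

section WalkPoly

variable {R : Type*} [CommRing R]

/-- The polynomials `A_m` with `A_0 = 1`, `A_1 = X`, `A_2 = X² - (a + 1)` and
`A_{m+1} = X A_m - a A_{m-1}`. For `a = q` and `X` the adjacency operator of a `(q + 1)`-regular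
graph they count the walks without backtracking. -/
noncomputable def walkPoly (a : R) : ℕ → R[X]
  | 0 => 1
  | 1 => X
  | 2 => X * X - C (a + 1)
  | m + 3 => X * walkPoly a (m + 2) - C a * walkPoly a (m + 1)

theorem walkPoly_add_three (a : R) (m : ℕ) :
    walkPoly a (m + 3) = X * walkPoly a (m + 2) - C a * walkPoly a (m + 1) := rfl

theorem walkPoly_sub (a : R) (m : ℕ) :
    walkPoly a (m + 3) - C a * walkPoly a (m + 1) = dickson 1 a (m + 3) - dickson 1 a (m + 1) := by
  induction m using Nat.twoStepInduction with
  | zero =>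
    simp only [walkPoly, dickson_add_two, zero_add, dickson_one, dickson_zero, map_add, map_one,
      Nat.cast_one]
    ring
  | one =>
    simp only [walkPoly, dickson_add_two, zero_add, dickson_one, dickson_zero, map_add, map_one,
      Nat.cast_one]
    ring
  | more m ih ih_succ =>
    linear_combination walkPoly_add_three a (m + 2) - dickson_add_two 1 a (m + 3)
      + dickson_add_two 1 a (m + 1) - C a * walkPoly_add_three a m + X * ih_succ - C a * ih

end WalkPoly

section Kernel

variable {V : Type*} (G : SimpleGraph V) [G.LocallyFinite] {q : ℕ}
  (hreg : G.IsRegularOfDegree (q + 1))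

open Classical in
theorem aeval_walkPoly_apply (m : ℕ) (x y : V) :
    (aeval (adjOp G fun v => (hreg v).le) (walkPoly (q : ℂ) m) (lp.single 2 y 1)) x
      = (properWalks G m x y).ncard := by
  set A := adjOp G fun v => (hreg v).le with hA
  induction m using Nat.strong_induction_on generalizing x with
  | _ m ih =>
    match m with
    | 0 =>
      rw [ncard_properWalks_zero]
      simp [walkPoly, Pi.single_apply]
    | 1 =>
      rw [ncard_properWalks_one]
      simp only [walkPoly, aeval_X, hA, adjOp_apply, ncard_properWalks_zero]
      simp [Pi.single_apply]
    | 2 =>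
      have hrec := congrArg (fun n : ℕ => (n : ℂ)) (ncard_properWalks_two hreg x y)
      push_cast at hrec
      rw [eq_sub_of_add_eq hrec, ← ih 0 (by omega) x]
      simp only [← ih 1 (by omega), walkPoly, map_sub, map_mul, aeval_C, aeval_X, map_one,
        Algebra.algebraMap_eq_smul_one]
      rfl
    | m + 3 =>
      have hrec := congrArg (fun n : ℕ => (n : ℂ)) (ncard_properWalks_add_three hreg m x y)
      push_cast at hrec
      rw [eq_sub_of_add_eq hrec, ← ih (m + 1) (by omega) x]
      simp only [← ih (m + 2) (by omega), walkPoly, map_sub, map_mul, aeval_C, aeval_X,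
        Algebra.algebraMap_eq_smul_one, smul_one_mul]
      rfl

theorem traceCLM_walkPoly (Γ : Subgroup (G ≃g G)) [Fintype (MulAction.orbitRel.Quotient Γ V)]
    (m : ℕ) :
    traceCLM G Γ (aeval (adjOp G fun v => (hreg v).le) (walkPoly (q : ℂ) m))
      = ∑ o : MulAction.orbitRel.Quotient Γ V, ((properWalks G m o.out o.out).ncard : ℂ) := by
  rw [traceCLM_apply, traceΓ, finsum_eq_sum_of_fintype]
  exact Finset.sum_congr rfl fun o _ => aeval_walkPoly_apply G hreg m _ _

end Kernel

section TailWalks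

variable {V : Type*} (G : SimpleGraph V)

/-- The closed walks of length `m` at `x` without backtracking and without tail. -/
def reducedWalks (m : ℕ) (x : V) : Set (ℕ → V) :=
  {w ∈ properWalks G m x x | w 1 ≠ w (m - 1)}

/-- A closed walk of length `m` without backtracking whose first and last edges agree. -/
def IsTailWalk (m : ℕ) (w : ℕ → V) : Prop := IsProperWalk G m w ∧ w 0 = w m ∧ w 1 = w (m - 1)

/-- The walk of length `m` obtained from a walk of length `m + 2` by deleting both end points. -/
def middleWalk (m : ℕ) (w : ℕ → V) : ℕ → V := fun i => w (min i m + 1)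

/-- The walk `w` of length `m` with the vertex `x` added at the end. -/
def snocWalk (m : ℕ) (w : ℕ → V) (x : V) : ℕ → V := fun i => if i ≤ m then w i else x

theorem snocWalk_of_le {i m : ℕ} (hi : i ≤ m) (w : ℕ → V) (x : V) : snocWalk m w x i = w i :=
  if_pos hi

theorem snocWalk_of_lt {i m : ℕ} (hi : m < i) (w : ℕ → V) (x : V) : snocWalk m w x i = x :=
  if_neg hi.not_ge

theorem middleWalk_of_le {i m : ℕ} (hi : i ≤ m) (w : ℕ → V) : middleWalk m w i = w (i + 1) :=
  congrArg (fun j => w (j + 1)) (min_eq_left hi)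

theorem middleWalk_of_ge {i m : ℕ} (hi : m ≤ i) (w : ℕ → V) : middleWalk m w i = w (m + 1) :=
  congrArg (fun j => w (j + 1)) (min_eq_right hi)

variable {G}

theorem IsProperWalk.snocWalk {m : ℕ} {w : ℕ → V} {x : V} (hw : IsProperWalk G (m + 1) w)
    (hadj : G.Adj (w (m + 1)) x) (hne : w m ≠ x) :
    IsProperWalk G (m + 2) (snocWalk (m + 1) w x) := by
  refine ⟨fun i hi => ?_, fun i hi => ?_, fun i hi => ?_⟩
  · rw [snocWalk_of_le (by omega)]
    rcases Nat.lt_or_ge i (m + 1) with h | h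
    · rw [snocWalk_of_le h]
      exact hw.1 i h
    · rwa [snocWalk_of_lt (by omega), show i = m + 1 by omega]
  · rw [snocWalk_of_le (by omega)]
    rcases Nat.lt_or_ge i m with h | h
    · rw [snocWalk_of_le (by omega)]
      exact hw.2.1 i (by omega)
    · rwa [snocWalk_of_lt (by omega), show i = m by omega]
  · rw [snocWalk_of_lt (by omega), snocWalk_of_lt (by omega)]

theorem IsTailWalk.middleWalk_mem {m : ℕ} {w : ℕ → V} (hw : IsTailWalk G (m + 2) w) :
    middleWalk m w ∈ properWalks G m (w 1) (w 1) := by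
  obtain ⟨⟨hadj, hne, -⟩, -, htail⟩ := hw
  refine ⟨⟨fun i hi => ?_, fun i hi => ?_, fun i hi => ?_⟩, middleWalk_of_le (Nat.zero_le m) w,
    (middleWalk_of_le le_rfl w).trans htail.symm⟩
  · rw [middleWalk_of_le hi.le, middleWalk_of_le hi]
    exact hadj (i + 1) (by omega)
  · rw [middleWalk_of_le (by omega), middleWalk_of_le hi]
    exact hne (i + 1) (by omega)
  · rw [middleWalk_of_ge hi, middleWalk_of_ge le_rfl]

theorem IsTailWalk.consWalk_snocWalk_middleWalk {m : ℕ} {w : ℕ → V}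
    (hw : IsTailWalk G (m + 2) w) :
    consWalk (w 0) (snocWalk m (middleWalk m w) (w 0)) = w := by
  obtain ⟨⟨-, -, hconst⟩, hclosed, -⟩ := hw
  funext i
  cases i with
  | zero => rfl
  | succ i =>
    change snocWalk m (middleWalk m w) (w 0) i = w (i + 1)
    rcases Nat.lt_or_ge m i with hi | hi
    · rw [snocWalk_of_lt hi, hclosed, hconst (i + 1) (by omega)]
    · rw [snocWalk_of_le hi, middleWalk_of_le hi]

theorem IsProperWalk.middleWalk_consWalk_snocWalk {m : ℕ} {w : ℕ → V} (hw : IsProperWalk G m w)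
    (x : V) : middleWalk m (consWalk x (IharaPeriodic.snocWalk m w x)) = w := by
  funext i
  rcases le_total i m with hi | hi
  · rw [middleWalk_of_le hi]
    exact snocWalk_of_le hi w x
  · rw [middleWalk_of_ge hi, hw.2.2 i hi]
    exact snocWalk_of_le le_rfl w x

theorem isTailWalk_consWalk_snocWalk {m : ℕ} {x y : V} {w : ℕ → V}
    (hw : w ∈ properWalks G (m + 1) y y) (hadj : G.Adj y x) (hfirst : x ≠ w 1)
    (hlast : x ≠ w m) : IsTailWalk G (m + 3) (consWalk x (snocWalk (m + 1) w x)) := by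
  obtain ⟨hw, h0, hy⟩ := hw
  refine ⟨isProperWalk_consWalk.2 ⟨hw.snocWalk (hy.symm ▸ hadj) hlast.symm, ?_, ?_⟩, ?_, ?_⟩
  · rw [snocWalk_of_le (Nat.zero_le _), h0]
    exact hadj.symm
  · rwa [snocWalk_of_le (by omega)]
  · exact (snocWalk_of_lt (Nat.lt_succ_self (m + 1)) w x).symm
  · change snocWalk (m + 1) w x 0 = snocWalk (m + 1) w x (m + 1)
    rw [snocWalk_of_le (Nat.zero_le _), snocWalk_of_le le_rfl, h0, hy]

theorem setOf_isTailWalk_middleWalk_eq {m : ℕ} {y : V} {w : ℕ → V}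
    (hw : w ∈ properWalks G (m + 1) y y) :
    {v ∈ {v | IsTailWalk G (m + 3) v ∧ v 1 = y} | middleWalk (m + 1) v = w}
      = (fun x => consWalk x (snocWalk (m + 1) w x)) '' {x | G.Adj y x ∧ x ≠ w 1 ∧ x ≠ w m} := by
  ext v
  constructor
  · rintro ⟨⟨hv, rfl⟩, rfl⟩
    refine ⟨v 0, ⟨(hv.1.1 0 (by omega)).symm, ?_, ?_⟩, hv.consWalk_snocWalk_middleWalk⟩
    · rw [middleWalk_of_le (by omega)]
      exact hv.1.2.1 0 (by omega)
    · rw [middleWalk_of_le (by omega), hv.2.1]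
      exact (hv.1.2.1 (m + 1) (by omega)).symm
  · rintro ⟨x, ⟨hadj, hfirst, hlast⟩, rfl⟩
    exact ⟨⟨isTailWalk_consWalk_snocWalk hw hadj hfirst hlast,
      (snocWalk_of_le (Nat.zero_le _) w x).trans hw.2.1⟩, hw.1.middleWalk_consWalk_snocWalk x⟩

theorem properWalks_one_self (x : V) : properWalks G 1 x x = ∅ := by
  refine Set.eq_empty_of_forall_notMem ?_
  rintro w ⟨⟨hadj, -, -⟩, h0, h1⟩
  exact (hadj 0 (by omega)).ne (h0.trans h1.symm)

theorem properWalks_two_self (x : V) : properWalks G 2 x x = ∅ := by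
  refine Set.eq_empty_of_forall_notMem ?_
  rintro w ⟨⟨-, hne, -⟩, h0, h2⟩
  exact hne 0 (by omega) (h0.trans h2.symm)

theorem reducedWalks_eq_empty {m : ℕ} {x : V} (h : properWalks G m x x = ∅) :
    reducedWalks G m x = ∅ :=
  Set.subset_empty_iff.1 (h ▸ Set.sep_subset _ _)

variable [G.LocallyFinite]

theorem finite_setOf_isTailWalk_zero (m : ℕ) (y : V) :
    {w | IsTailWalk G m w ∧ w 0 = y}.Finite :=
  (finite_properWalks m y y).subset fun _ hw => ⟨hw.1.1, hw.2, hw.1.2.1.symm.trans hw.2⟩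

theorem finite_setOf_isTailWalk_one (m : ℕ) (y : V) :
    {w | IsTailWalk G (m + 1) w ∧ w 1 = y}.Finite := by
  refine Set.Finite.subset (Set.Finite.biUnion (Set.toFinite (G.neighborSet y)) fun z _ =>
    finite_setOf_isTailWalk_zero (G := G) (m + 1) z) ?_
  rintro w ⟨hw, rfl⟩
  exact Set.mem_biUnion (x := w 0) (hw.1.1 0 (by omega)).symm ⟨hw, rfl⟩

theorem ncard_setOf_isTailWalk_zero (m : ℕ) (x : V) :
    {w | IsTailWalk G m w ∧ w 0 = x}.ncard + (reducedWalks G m x).ncard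
      = (properWalks G m x x).ncard := by
  rw [← Set.ncard_inter_add_ncard_sdiff_eq_ncard (properWalks G m x x) {w | w 1 = w (m - 1)}
    (finite_properWalks m x x)]
  congr 2
  ext w
  constructor
  · rintro ⟨⟨hw, hclosed, htail⟩, rfl⟩
    exact ⟨⟨hw, rfl, hclosed.symm⟩, htail⟩
  · rintro ⟨⟨hw, rfl, hclosed⟩, htail⟩
    exact ⟨⟨hw, hclosed.symm, htail⟩, rfl⟩

variable {q : ℕ}

open Classical in
theorem ncard_setOf_adj_ne_ne (hreg : G.IsRegularOfDegree (q + 1)) {y a b : V} (ha : G.Adj y a)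
    (hb : G.Adj y b) :
    {x | G.Adj y x ∧ x ≠ a ∧ x ≠ b}.ncard + (if a ≠ b then 1 else 0) = q := by
  have hsdiff : {x | G.Adj y x ∧ x ≠ a ∧ x ≠ b} = (G.neighborSet y \ {a}) \ {b} := by
    ext x
    simp [and_assoc]
  have hcard : (G.neighborSet y \ {a}).ncard = q := by
    rw [Set.ncard_sdiff_singleton_of_mem (show a ∈ G.neighborSet y from ha)]
    exact congrArg (· - 1) (ncard_setOf_adj hreg y)
  rw [hsdiff]
  split_ifs with hab
  · have hb_mem : b ∈ G.neighborSet y \ {a} := ⟨hb, fun h => hab h.symm⟩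
    rw [Set.ncard_sdiff_singleton_add_one hb_mem (Set.toFinite _), hcard]
  · rw [← not_not.1 hab, Set.sdiff_singleton_eq_self (by simp), hcard, add_zero]

theorem ncard_setOf_isTailWalk_one (hreg : G.IsRegularOfDegree (q + 1)) (m : ℕ) (y : V) :
    {w | IsTailWalk G (m + 3) w ∧ w 1 = y}.ncard + (reducedWalks G (m + 1) y).ncard
      = q * (properWalks G (m + 1) y y).ncard := by
  classical
  have hfinite := finite_properWalks (G := G) (m + 1) y y
  have hreduced : (reducedWalks G (m + 1) y).ncard
      = ∑ w ∈ hfinite.toFinset, if w 1 ≠ w m then 1 else 0 := by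
    rw [← Finset.card_filter, ← Set.ncard_coe_finset]
    congr 1
    ext w
    simp [reducedWalks]
  have hmiddle : Set.MapsTo (middleWalk (m + 1)) {w | IsTailWalk G (m + 3) w ∧ w 1 = y}
      hfinite.toFinset := by
    rintro w ⟨hw, rfl⟩
    exact Finset.mem_coe.2 ((Set.Finite.mem_toFinset _).2 hw.middleWalk_mem)
  rw [hreduced, ncard_eq_sum_ncard_fiber (finite_setOf_isTailWalk_one (m + 2) y) hmiddle,
    ← Finset.sum_add_distrib, Finset.sum_eq_card_nsmul (b := q) fun w hw => ?_,
    Set.ncard_eq_toFinset_card _ hfinite, smul_eq_mul, mul_comm]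
  have hw' := (Set.Finite.mem_toFinset _).1 hw
  rw [setOf_isTailWalk_middleWalk_eq hw',
    Set.ncard_image_of_injective _ fun x x' h => congrFun h 0]
  exact ncard_setOf_adj_ne_ne hreg (hw'.2.1 ▸ hw'.1.1 0 (by omega))
    (hw'.2.2 ▸ (hw'.1.1 m (by omega)).symm)

end TailWalks

section WalkCount

variable {V : Type*} {G : SimpleGraph V} [G.LocallyFinite] (Γ : Subgroup (G ≃g G)) {q : ℕ}

theorem powerTrace_sub [Fintype (orbitRel.Quotient Γ V)]
    (hreg : G.IsRegularOfDegree (q + 1)) (m : ℕ) :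
    powerTrace G hreg Γ (m + 3) - powerTrace G hreg Γ (m + 1)
      = ∑ o : orbitRel.Quotient Γ V, ((properWalks G (m + 3) o.out o.out).ncard : ℂ)
        - q * ∑ o : orbitRel.Quotient Γ V, ((properWalks G (m + 1) o.out o.out).ncard : ℂ) := by
  have h := congrArg (fun P => traceCLM G Γ (aeval (adjOp G fun v => (hreg v).le) P))
    (walkPoly_sub (q : ℂ) m)
  simp only [map_sub, ← smul_eq_C_mul, map_smul, smul_eq_mul,
    traceCLM_walkPoly G hreg Γ] at h
  exact h.symm

variable [Finite (orbitRel.Quotient Γ V)]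

theorem powerTrace_one (hreg : G.IsRegularOfDegree (q + 1)) : powerTrace G hreg Γ 1 = 0 := by
  let _ := Fintype.ofFinite (orbitRel.Quotient Γ V)
  have h := traceCLM_walkPoly G hreg Γ 1
  simp only [properWalks_one_self, Set.ncard_empty, Nat.cast_zero, Finset.sum_const_zero] at h
  rwa [powerTrace, dickson_one]

theorem powerTrace_two (hreg : G.IsRegularOfDegree (q + 1)) :
    powerTrace G hreg Γ 2 = -((q - 1) * cardVB G Γ) := by
  let _ := Fintype.ofFinite (orbitRel.Quotient Γ V)
  have hdickson : dickson 1 (q : ℂ) 2 = walkPoly (q : ℂ) 2 - C ((q : ℂ) - 1) := by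
    simp only [walkPoly, dickson_two, map_add, map_sub, map_one]
    norm_num
    ring
  rw [powerTrace, hdickson, map_sub, aeval_C, map_sub, traceCLM_algebraMap,
    traceCLM_walkPoly G hreg Γ 2]
  simp only [properWalks_two_self, Set.ncard_empty, Nat.cast_zero, Finset.sum_const_zero, zero_sub]

end WalkCount

section Orbits

variable {V : Type*} {G : SimpleGraph V} (Γ : Subgroup (G ≃g G))

variable (G) in
/-- The closed walks of length `m` without backtracking and with a tail, acted on by `Γ`. -/
def tailWalks (m : ℕ) : SubMulAction Γ (ℕ → V) where
  carrier := {w | IsTailWalk G m w}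
  smul_mem' γ _ h :=
    ⟨⟨fun i hi => γ.1.map_adj_iff.2 (h.1.1 i hi), fun i hi heq => h.1.2.1 i hi (γ.1.injective heq),
      fun i hi => congrArg γ.1 (h.1.2.2 i hi)⟩, congrArg γ.1 h.2.1, congrArg γ.1 h.2.2⟩

variable (G) in
/-- The map sending a walk to its `i`-th vertex. -/
def tailWalkVert (m i : ℕ) : tailWalks G Γ m →[Γ] V where
  toFun w := w.1 i
  map_smul' _ _ := rfl

variable [Fintype (orbitRel.Quotient Γ V)] [IsCancelSMul Γ V]

theorem card_orbits_tailWalks {m i : ℕ} (hfin : ∀ y, {w | IsTailWalk G m w ∧ w i = y}.Finite) :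
    Nat.card (orbitRel.Quotient Γ (tailWalks G Γ m))
      = ∑ o : orbitRel.Quotient Γ V, {w | IsTailWalk G m w ∧ w i = o.out}.ncard := by
  have e (y : V) : {w // tailWalkVert G Γ m i w = y} ≃ {w | IsTailWalk G m w ∧ w i = y} :=
    Equiv.subtypeSubtypeEquivSubtypeInter (IsTailWalk G m) fun w => w i = y
  rw [card_orbits_eq_sum (tailWalkVert G Γ m i) fun y =>
    have := (hfin y).to_subtype
    Finite.of_equiv _ (e y).symm]
  simp only [Nat.card_congr (e _), Nat.card_coe_set_eq]

variable [G.LocallyFinite] {q : ℕ}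

theorem sum_ncard_reducedWalks_rec (hreg : G.IsRegularOfDegree (q + 1)) (m : ℕ) :
    ∑ o : orbitRel.Quotient Γ V, (properWalks G (m + 3) o.out o.out).ncard
        + ∑ o : orbitRel.Quotient Γ V, (reducedWalks G (m + 1) o.out).ncard
      = ∑ o : orbitRel.Quotient Γ V, (reducedWalks G (m + 3) o.out).ncard
        + q * ∑ o : orbitRel.Quotient Γ V, (properWalks G (m + 1) o.out o.out).ncard := by
  -- Up to `Γ`, the walks with a tail are counted by their first or by their second vertex.
  have htail := (card_orbits_tailWalks Γ (finite_setOf_isTailWalk_zero (m + 3))).symm.trans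
    (card_orbits_tailWalks Γ (finite_setOf_isTailWalk_one (m + 2)))
  have hzero := Finset.sum_congr rfl fun (o : orbitRel.Quotient Γ V) (_ : o ∈ Finset.univ) =>
    ncard_setOf_isTailWalk_zero (G := G) (m + 3) o.out
  have hone := Finset.sum_congr rfl fun (o : orbitRel.Quotient Γ V) (_ : o ∈ Finset.univ) =>
    ncard_setOf_isTailWalk_one hreg m o.out
  rw [Finset.sum_add_distrib] at hzero hone
  rw [← Finset.mul_sum] at hone
  omega

theorem sum_ncard_reducedWalks (hreg : G.IsRegularOfDegree (q + 1)) (m : ℕ) :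
    ((∑ o : orbitRel.Quotient Γ V, (reducedWalks G (m + 1) o.out).ncard : ℕ) : ℂ)
      = powerTrace G hreg Γ (m + 1) + if Even (m + 1) then (q - 1) * (cardVB G Γ : ℂ) else 0 := by
  induction m using Nat.twoStepInduction with
  | zero => simp [powerTrace_one, reducedWalks_eq_empty (properWalks_one_self _)]
  | one => simp [powerTrace_two, reducedWalks_eq_empty (properWalks_two_self _)]
  | more m ih _ =>
    have hrec := congrArg (fun n : ℕ => (n : ℂ)) (sum_ncard_reducedWalks_rec Γ hreg m)
    push_cast at hrec ih ⊢
    simp only [show Even (m + 2 + 1) ↔ Even (m + 1) by simp [Nat.even_add_one]]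
    linear_combination ih - hrec - powerTrace_sub Γ hreg m

end Orbits

/-! ### Prime cycles and the Euler product -/

section Shift

variable {V : Type*}

/-- The shift of a sequence; a sequence has period `n` when it is an `n`-periodic point of it. -/
def shift (w : ℕ → V) : ℕ → V := fun i => w (i + 1)

theorem shift_iterate (n : ℕ) (w : ℕ → V) : shift^[n] w = fun i => w (i + n) := by
  induction n generalizing w with
  | zero => rfl
  | succ n ih =>
    rw [iterate_succ_apply, ih]
    exact funext fun i => congrArg w (by omega)

theorem isPeriodicPt_shift_iff {n : ℕ} {w : ℕ → V} :
    IsPeriodicPt shift n w ↔ ∀ i, w (i + n) = w i := by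
  rw [IsPeriodicPt, IsFixedPt, shift_iterate, funext_iff]

theorem apply_mod_of_le {m : ℕ} {w : ℕ → V} (hclosed : w 0 = w m) {i : ℕ} (hi : i ≤ m) :
    w (i % m) = w i := by
  rcases hi.lt_or_eq with h | rfl
  · rw [Nat.mod_eq_of_lt h]
  · rw [Nat.mod_self, hclosed]

end Shift

namespace ClosedPath

variable {V : Type*} {G : SimpleGraph V}

section Reduced

theorem vert_mod (C : ClosedPath G) (i : ℕ) : C.vert (i % C.len) = C.vert i :=
  Periodic.map_mod_nat C.periodic i

theorem vert_len (C : ClosedPath G) : C.vert C.len = C.vert 0 := by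
  rw [← C.periodic 0, zero_add]

theorem one_lt_len (C : ClosedPath G) : 1 < C.len := by
  refine lt_of_le_of_ne C.len_pos fun h => (C.adj 0).ne ?_
  rw [zero_add, h, C.vert_len]

theorem IsProper.vert_ne {C : ClosedPath G} (hC : C.IsProper) {i : ℕ} (hi : i + 2 ≤ C.len) :
    C.vert i ≠ C.vert (i + 2) :=
  hC (i + 1) (by omega) (by omega)

-- `HasTail` is false below length `4`, so lengths `2` and `3` need another reason.
theorem IsReduced.vert_one_ne {C : ClosedPath G} (hC : C.IsReduced) :
    C.vert 1 ≠ C.vert (C.len - 1) := by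
  intro heq
  rcases Nat.lt_or_ge C.len 4 with h | h
  · obtain h2 | h3 : C.len = 2 ∨ C.len = 3 := by
      have := C.one_lt_len
      omega
    · exact hC.1.vert_ne (i := 0) h2.ge (by rw [zero_add, ← h2, C.vert_len])
    · exact (C.adj 1).ne (by rwa [h3] at heq)
  · refine hC.2 ⟨1, le_rfl, by omega, fun j hj hj' => ?_⟩
    rwa [le_antisymm hj' hj]

theorem isReduced_iff_isProper {C : ClosedPath G} :
    C.IsReduced ↔ C.IsProper ∧ C.vert 1 ≠ C.vert (C.len - 1) :=
  ⟨fun h => ⟨h.1, h.vert_one_ne⟩, fun h => ⟨h.1, fun ⟨_, hk, _, htail⟩ => h.2 (htail 1 le_rfl hk)⟩⟩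

theorem isReduced_iff_forall_vert_ne {C : ClosedPath G} :
    C.IsReduced ↔ ∀ i, C.vert i ≠ C.vert (i + 2) := by
  have hpos := C.one_lt_len
  have hend : C.vert (C.len - 1 + 2) = C.vert 1 := by
    rw [show C.len - 1 + 2 = 1 + C.len by omega, C.periodic]
  refine ⟨fun hC i => ?_, fun h => isReduced_iff_isProper.2 ⟨fun i hi _ => ?_, fun heq => ?_⟩⟩
  · have hmod : C.vert (i + 2) = C.vert (i % C.len + 2) := by
      rw [← C.vert_mod (i + 2), ← C.vert_mod (i % C.len + 2), Nat.mod_add_mod]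
    rw [← C.vert_mod i, hmod]
    have hlt := Nat.mod_lt i C.len_pos
    rcases Nat.lt_or_ge (i % C.len + 1) C.len with h | h
    · exact hC.1.vert_ne h
    · rw [show i % C.len = C.len - 1 by omega, hend]
      exact hC.vert_one_ne.symm
  · have := h (i - 1)
    rwa [show i - 1 + 2 = i + 1 by omega] at this
  · exact h (C.len - 1) (by rw [hend, heq])

end Reduced

section Walk

/-- One turn of a closed path as a walk: its vertices up to `C.len`, then constant. -/
def walk (C : ClosedPath G) (i : ℕ) : V := C.vert (min i C.len)

theorem walk_of_le (C : ClosedPath G) {i : ℕ} (hi : i ≤ C.len) : C.walk i = C.vert i :=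
  congrArg C.vert (min_eq_left hi)

theorem walk_of_ge (C : ClosedPath G) {i : ℕ} (hi : C.len ≤ i) : C.walk i = C.vert 0 := by
  rw [walk, min_eq_right hi, C.vert_len]

theorem IsReduced.walk_mem_reducedWalks {C : ClosedPath G} (hC : C.IsReduced) :
    C.walk ∈ reducedWalks G C.len (C.vert 0) := by
  have hpos := C.len_pos
  refine ⟨⟨⟨fun i hi => ?_, fun i hi => ?_, fun i hi => ?_⟩, C.walk_of_le hpos.le,
    C.walk_of_ge le_rfl⟩, ?_⟩
  · rw [C.walk_of_le hi.le, C.walk_of_le hi]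
    exact C.adj i
  · rw [C.walk_of_le (by omega), C.walk_of_le hi]
    exact hC.1.vert_ne hi
  · rw [C.walk_of_ge hi, C.walk_of_ge le_rfl]
  · rw [C.walk_of_le hpos, C.walk_of_le (Nat.sub_le _ _)]
    exact hC.vert_one_ne

/-- The closed path running periodically through a closed walk. -/
def ofWalk {m : ℕ} (hm : 0 < m) {w : ℕ → V} (hadj : ∀ i < m, G.Adj (w i) (w (i + 1)))
    (hclosed : w 0 = w m) : ClosedPath G where
  len := m
  vert i := w (i % m)
  len_pos := hm
  periodic i := by rw [Nat.add_mod_right]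
  adj i := by
    have hlt := Nat.mod_lt i hm
    rw [← Nat.mod_add_mod, apply_mod_of_le hclosed hlt]
    exact hadj _ hlt

theorem isReduced_ofWalk {m : ℕ} (hm : 0 < m) {x : V} {w : ℕ → V} (hw : w ∈ reducedWalks G m x) :
    (ofWalk hm hw.1.1.1 (hw.1.2.1.trans hw.1.2.2.symm)).IsReduced := by
  have hvert {i : ℕ} (hi : i ≤ m) : w (i % m) = w i :=
    apply_mod_of_le (hw.1.2.1.trans hw.1.2.2.symm) hi
  refine isReduced_iff_isProper.2 ⟨fun i hi hi' => ?_, ?_⟩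
  · change i + 1 ≤ m at hi'
    change w ((i - 1) % m) ≠ w ((i + 1) % m)
    rw [hvert (by omega), hvert hi']
    have := hw.1.1.2.1 (i - 1) (by omega)
    rwa [show i - 1 + 2 = i + 1 by omega] at this
  · change w (1 % m) ≠ w ((m - 1) % m)
    rw [hvert hm, hvert (Nat.sub_le _ _)]
    exact hw.2

end Walk

section Root

theorem isPeriodicPt (C : ClosedPath G) : IsPeriodicPt shift C.len C.vert :=
  isPeriodicPt_shift_iff.2 C.periodic

/-- The primitive closed path of which `C` is a multiple. -/
noncomputable def root (C : ClosedPath G) : ClosedPath G where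
  len := minimalPeriod shift C.vert
  vert := C.vert
  len_pos := C.isPeriodicPt.minimalPeriod_pos C.len_pos
  periodic := isPeriodicPt_shift_iff.1 (isPeriodicPt_minimalPeriod shift C.vert)
  adj := C.adj

theorem root_len_dvd (C : ClosedPath G) : C.root.len ∣ C.len :=
  C.isPeriodicPt.minimalPeriod_dvd

theorem isPrimitive_root (C : ClosedPath G) : C.root.IsPrimitive := by
  rintro ⟨D, n, hn, hlen, hvert⟩
  have hperiodic : IsPeriodicPt shift D.len C.vert := by
    rw [show C.vert = D.vert from funext hvert]
    exact D.isPeriodicPt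
  have hle : C.root.len ≤ D.len := hperiodic.minimalPeriod_le D.len_pos
  have htwo_mul : 2 * D.len ≤ n * D.len := Nat.mul_le_mul_right _ hn
  have := D.len_pos
  omega

theorem IsPrimitive.minimalPeriod_eq {C : ClosedPath G} (hC : C.IsPrimitive) :
    minimalPeriod shift C.vert = C.len := by
  obtain ⟨n, hn⟩ := C.root_len_dvd
  have hlt_two : n < 2 := by
    by_contra! h
    exact hC ⟨C.root, n, h, by rw [hn, mul_comm], fun _ => rfl⟩
  have hne_zero : n ≠ 0 := by
    rintro rfl
    exact C.len_pos.ne' hn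
  rw [hn, show n = 1 by omega, mul_one]
  rfl

theorem IsReduced.root {C : ClosedPath G} (hC : C.IsReduced) : C.root.IsReduced :=
  isReduced_iff_forall_vert_ne.2 fun i => isReduced_iff_forall_vert_ne.1 hC i

theorem root_smul (γ : G ≃g G) (C : ClosedPath G) : (γ • C).root = γ • C.root := by
  refine ClosedPath.ext (minimalPeriod_eq_minimalPeriod_iff.2 fun n => ?_) rfl
  rw [isPeriodicPt_shift_iff, isPeriodicPt_shift_iff]
  exact forall_congr' fun i => γ.injective.eq_iff

theorem minimalPeriod_shift_vert_add (C : ClosedPath G) (k : ℕ) :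
    minimalPeriod shift (fun i => C.vert (i + k)) = minimalPeriod shift C.vert := by
  rw [← shift_iterate,
    minimalPeriod_apply_iterate (mk_mem_periodicPts C.len_pos C.isPeriodicPt) k]

/-- The closed path of length `m` that runs along `C`, starting from the vertex `C.vert k`. -/
def multiple (C : ClosedPath G) {m : ℕ} (hm : 0 < m) (h : C.len ∣ m) (k : ℕ) : ClosedPath G where
  len := m
  vert i := C.vert (i + k)
  len_pos := hm
  periodic i := by
    obtain ⟨n, rfl⟩ := h
    rw [add_right_comm, mul_comm, C.vert_add_mul]
  adj i := by
    rw [add_right_comm]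
    exact C.adj _

theorem IsReduced.multiple {C : ClosedPath G} (hC : C.IsReduced) {m : ℕ} (hm : 0 < m)
    (h : C.len ∣ m) (k : ℕ) : (C.multiple hm h k).IsReduced :=
  isReduced_iff_forall_vert_ne.2 fun i => by
    change C.vert (i + k) ≠ C.vert (i + 2 + k)
    rw [add_right_comm]
    exact isReduced_iff_forall_vert_ne.1 hC (i + k)

theorem IsPrimitive.mk_root_multiple {C : ClosedPath G} (hC : C.IsPrimitive) {m : ℕ} (hm : 0 < m)
    (h : C.len ∣ m) (k : ℕ) :
    (Quotient.mk _ (C.multiple hm h k).root : PathCycle G) = Quotient.mk _ C := by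
  have hlen : C.len = (C.multiple hm h k).root.len :=
    ((C.minimalPeriod_shift_vert_add k).trans hC.minimalPeriod_eq).symm
  exact (Quotient.sound (show C ≈ (C.multiple hm h k).root from ⟨hlen, k, fun _ => rfl⟩)).symm

theorem IsPrimitive.vert_add_injOn {C : ClosedPath G} (hC : C.IsPrimitive) :
    Set.InjOn (fun k i => C.vert (i + k)) (Set.Iio C.len) := by
  have := iterate_injOn_Iio_minimalPeriod (f := shift) (x := C.vert)
  simpa only [shift_iterate, hC.minimalPeriod_eq] using this

end Root

section ReducedPaths

variable (G) in
/-- The reduced closed paths of length `m`, with the action of `Γ`. -/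
def reducedPaths (Γ : Subgroup (G ≃g G)) (m : ℕ) : SubMulAction Γ (ClosedPath G) where
  carrier := {C | C.IsReduced ∧ C.len = m}
  smul_mem' γ _ h := ⟨isReduced_iff_forall_vert_ne.2 fun i heq =>
    isReduced_iff_forall_vert_ne.1 h.1 i (γ.1.injective heq), h.2⟩

variable (G) in
/-- The map sending a reduced closed path to its origin. -/
def pathOrigin (Γ : Subgroup (G ≃g G)) (m : ℕ) : reducedPaths G Γ m →[Γ] V where
  toFun C := C.1.vert 0
  map_smul' _ _ := rfl

variable (G) in
/-- The map sending a reduced closed path to the prime cycle of which it is a multiple. -/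
noncomputable def rootCycle (Γ : Subgroup (G ≃g G)) (m : ℕ) :
    reducedPaths G Γ m →[Γ] PathCycle G where
  toFun C := Quotient.mk _ C.1.root
  map_smul' γ C := congrArg (Quotient.mk _) (root_smul γ.1 C.1)

variable (Γ : Subgroup (G ≃g G)) {m : ℕ} (hm : 0 < m)

/-- The reduced closed paths of length `m` at `x` correspond to the closed walks at `x` without
backtracking and without tail. -/
def pathOriginFiberEquiv (x : V) : {C // pathOrigin G Γ m C = x} ≃ reducedWalks G m x where
  toFun C := ⟨C.1.1.walk, by
    obtain ⟨⟨C, hC, rfl⟩, rfl⟩ := C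
    exact hC.walk_mem_reducedWalks⟩
  invFun w := ⟨⟨_, isReduced_ofWalk hm w.2, rfl⟩, by
    change w.1 (0 % m) = x
    rw [Nat.zero_mod, w.2.1.2.1]⟩
  left_inv := by
    rintro ⟨⟨C, hC, rfl⟩, rfl⟩
    refine Subtype.ext (Subtype.ext (ClosedPath.ext rfl (funext fun i => ?_)))
    change C.walk (i % C.len) = C.vert i
    rw [C.walk_of_le (Nat.mod_lt i hm).le, C.vert_mod]
  right_inv := by
    rintro ⟨w, hw⟩
    refine Subtype.ext (funext fun i => ?_)
    change w (min i m % m) = w i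
    rw [apply_mod_of_le (hw.1.2.1.trans hw.1.2.2.symm) (min_le_right i m)]
    rcases Nat.le_total i m with h | h
    · rw [min_eq_left h]
    · rw [min_eq_right h, hw.1.1.2.2 i h]

include hm

theorem finite_pathOrigin_fiber [G.LocallyFinite] (x : V) :
    Finite {C // pathOrigin G Γ m C = x} := by
  have : Finite (reducedWalks G m x) :=
    ((finite_properWalks m x x).subset (Set.sep_subset _ _)).to_subtype
  exact Finite.of_equiv _ (pathOriginFiberEquiv Γ hm x).symm

theorem finite_orbits_reducedPaths [G.LocallyFinite] [Finite (orbitRel.Quotient Γ V)] :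
    Finite (orbitRel.Quotient Γ (reducedPaths G Γ m)) :=
  finite_orbits (pathOrigin G Γ m) (finite_pathOrigin_fiber Γ hm)

theorem card_orbits_reducedPaths [G.LocallyFinite] [IsCancelSMul Γ V]
    [Fintype (orbitRel.Quotient Γ V)] :
    Nat.card (orbitRel.Quotient Γ (reducedPaths G Γ m))
      = ∑ o : orbitRel.Quotient Γ V, (reducedWalks G m o.out).ncard := by
  rw [card_orbits_eq_sum (pathOrigin G Γ m) (finite_pathOrigin_fiber Γ hm)]
  exact Finset.sum_congr rfl fun o _ => Nat.card_congr (pathOriginFiberEquiv Γ hm _)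

theorem IsPrimitive.card_rootCycle_fiber {C : ClosedPath G} (hC : C.IsPrimitive)
    (hCr : C.IsReduced) (h : C.len ∣ m) :
    Nat.card {D // rootCycle G Γ m D = Quotient.mk _ C} = C.len := by
  rw [← Nat.card_fin C.len]
  refine (Nat.card_eq_of_bijective (fun k : Fin C.len =>
    ⟨⟨C.multiple hm h k, hCr.multiple hm h k, rfl⟩, hC.mk_root_multiple hm h k⟩) ⟨?_, ?_⟩).symm
  · intro k k' heq
    refine Fin.ext (hC.vert_add_injOn k.2 k'.2 ?_)
    exact congrArg (fun D => D.1.1.vert) heq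
  · rintro ⟨⟨D, hD, rfl⟩, hDC⟩
    obtain ⟨-, k, hk⟩ := Quotient.exact hDC.symm
    refine ⟨⟨k % C.len, Nat.mod_lt k C.len_pos⟩, Subtype.ext (Subtype.ext
      (ClosedPath.ext rfl (funext fun i => ?_)))⟩
    change C.vert (i + k % C.len) = D.vert i
    rw [← C.vert_mod, Nat.add_mod_mod, C.vert_mod]
    exact (hk i).symm

theorem card_rootCycle_fiber {c : PathCycle G} (hc : c.IsPrime) :
    Nat.card {D // rootCycle G Γ m D = c} = if c.len ∣ m then c.len else 0 := by
  obtain ⟨C, hCr, hC, rfl⟩ := hc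
  split_ifs with h
  · exact hC.card_rootCycle_fiber Γ hm hCr h
  · rw [Nat.card_eq_zero]
    refine Or.inl ⟨?_⟩
    rintro ⟨⟨D, hD, rfl⟩, hDC⟩
    obtain ⟨hlen, -⟩ := Quotient.exact hDC
    change D.root.len = C.len at hlen
    exact h (hlen ▸ D.root_len_dvd : C.len ∣ D.len)

end ReducedPaths

end ClosedPath

section Series

theorem norm_lt_one_of_lt_one_div {q : ℕ} (hq : 1 ≤ q) {u : ℂ} (hu : ‖u‖ < 1 / q) : ‖u‖ < 1 :=
  hu.trans_le ((div_le_one (by positivity)).2 (by exact_mod_cast hq))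

theorem hasSum_pow_div_mul_ite_dvd {l : ℕ} (hl : 0 < l) {u : ℂ} (hu : ‖u‖ < 1) (c : ℂ) :
    HasSum (fun m : ℕ => u ^ m / m * if l ∣ m then l * c else 0) (c * -log (1 - u ^ l)) := by
  have hl0 : (l : ℂ) ≠ 0 := by exact_mod_cast hl.ne'
  have hul : ‖u ^ l‖ < 1 := by
    rw [norm_pow]
    exact pow_lt_one₀ (norm_nonneg u) hu hl.ne'
  rw [← Function.Injective.hasSum_iff (mul_right_injective₀ hl.ne')]
  · refine ((hasSum_taylorSeries_neg_log hul).mul_left c).congr_fun fun k => ?_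
    simp only [Function.comp_apply, if_pos (Nat.dvd_mul_right l k), Nat.cast_mul, pow_mul]
    field_simp
  · intro m hm
    rw [if_neg, mul_zero]
    rintro ⟨k, rfl⟩
    exact hm ⟨k, rfl⟩

theorem hasSum_natCard_fiber {α β : Type*} [Finite α] (f : α → β) :
    HasSum (fun b => Nat.card {a // f a = b}) (Nat.card α) := by
  classical
  let _ := Fintype.ofFinite α
  have hcard : Nat.card α = ∑ b ∈ Finset.univ.image f, Nat.card {a // f a = b} := by
    rw [Nat.card_eq_fintype_card, ← Finset.card_univ,
      Finset.card_eq_sum_card_image f Finset.univ]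
    exact Finset.sum_congr rfl fun b _ => by rw [Nat.card_eq_fintype_card, Fintype.card_subtype]
  rw [hcard]
  refine hasSum_sum_of_ne_finset_zero fun b hb => ?_
  rw [Nat.card_eq_zero]
  exact Or.inl ⟨fun ⟨a, ha⟩ => hb (Finset.mem_image.2 ⟨a, Finset.mem_univ a, ha⟩)⟩

theorem hasSum_swap_mul_natCast {ι κ 𝕜 : Type*} [RCLike 𝕜] {a : ι → 𝕜} {n : ι → κ → ℕ}
    {N : ι → ℕ} {S : κ → 𝕜} {L : 𝕜} (hrow : ∀ i, a i ≠ 0 → HasSum (n i) (N i))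
    (htotal : HasSum (fun i => a i * N i) L)
    (hcolumn : ∀ k, HasSum (fun i => a i * n i k) (S k)) : HasSum S L := by
  have hrow_mul (i : ι) : HasSum (fun k => a i * n i k) (a i * N i) := by
    rcases eq_or_ne (a i) 0 with h | h
    · simp only [h, zero_mul]
      exact hasSum_zero
    · exact ((hrow i h).map (Nat.castAddMonoidHom 𝕜) continuous_of_discreteTopology).mul_left _
  have hrow_norm (i : ι) : HasSum (fun k => ‖a i * n i k‖) ‖a i * N i‖ := by
    rcases eq_or_ne (a i) 0 with h | h
    · simp only [h, zero_mul, norm_zero]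
      exact hasSum_zero
    · simp only [norm_mul, RCLike.norm_natCast]
      exact ((hrow i h).map (Nat.castAddMonoidHom ℝ) continuous_of_discreteTopology).mul_left _
  have hsummable : Summable fun p : ι × κ => a p.1 * n p.1 p.2 := by
    refine Summable.of_norm ((summable_prod_of_nonneg fun p => norm_nonneg _).2
      ⟨fun i => (hrow_norm i).summable, ?_⟩)
    simp only [fun i => (hrow_norm i).tsum_eq]
    exact htotal.summable.norm
  have hprod : HasSum (fun p : ι × κ => a p.1 * n p.1 p.2) L := by
    have := hsummable.hasSum
    rwa [(this.prod_fiberwise hrow_mul).unique htotal] at this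
  exact ((Equiv.prodComm κ ι).hasSum_iff.2 hprod).prod_fiberwise hcolumn

end Series

section EulerProduct

variable {V : Type*} {G : SimpleGraph V} {Γ : Subgroup (G ≃g G)}

variable (G Γ) in
/-- The map sending the orbit of a reduced closed path to the class of the prime cycle of which the
path is a multiple. -/
noncomputable def primeClassMap (m : ℕ) :
    orbitRel.Quotient Γ (reducedPaths G Γ m) → PrimeClass G Γ :=
  Quotient.map (fun C => ⟨rootCycle G Γ m C, C.1.root, C.2.1.root, C.1.isPrimitive_root, rfl⟩) <| by
    rintro _ C ⟨γ, rfl⟩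
    exact ⟨γ, (map_smul (rootCycle G Γ m) γ C).symm⟩

theorem primeClassMap_eq_iff {m : ℕ} {o : orbitRel.Quotient Γ (reducedPaths G Γ m)}
    {P : PrimeClass G Γ} :
    primeClassMap G Γ m o = P ↔ orbitMap (rootCycle G Γ m) o = Quotient.mk _ P.out.1 := by
  induction o using Quotient.inductionOn with
  | _ C =>
    conv_lhs => rw [← Quotient.out_eq P]
    exact (Quotient.eq (y := P.out)).trans
      (Quotient.eq (r := orbitRel Γ (PathCycle G)) (y := P.out.1)).symm

namespace PrimeClass

/-- The length of a prime cycle in the class `P`. -/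
noncomputable def len (P : PrimeClass G Γ) : ℕ := P.out.1.len

/-- The order of the stabilizer of a prime cycle in the class `P`. -/
noncomputable def cardStab (P : PrimeClass G Γ) : ℕ := Nat.card (stabilizer Γ P.out.1)

/-- The number of orbits of reduced closed paths of length `m` that are multiples of a prime cycle
in the class `P`. -/
noncomputable def count (P : PrimeClass G Γ) (m : ℕ) : ℕ :=
  Nat.card {o // primeClassMap G Γ m o = P}

theorem len_pos (P : PrimeClass G Γ) : 0 < P.len := by
  obtain ⟨C, -, -, hC⟩ := P.out.2
  rw [len, ← hC]
  exact C.len_pos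

theorem hasSum_count [G.LocallyFinite] [Finite (orbitRel.Quotient Γ V)] {m : ℕ} (hm : 0 < m) :
    HasSum (fun P : PrimeClass G Γ => P.count m)
      (Nat.card (orbitRel.Quotient Γ (reducedPaths G Γ m))) := by
  have := finite_orbits_reducedPaths Γ hm
  exact hasSum_natCard_fiber (primeClassMap G Γ m)

variable [IsCancelSMul Γ V] (P : PrimeClass G Γ)

theorem count_mul_cardStab {m : ℕ} (hm : 0 < m) :
    P.count m * P.cardStab = if P.len ∣ m then P.len else 0 := by
  have := isCancelSMul_of_mulActionHom (pathOrigin G Γ m)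
  simp only [count, primeClassMap_eq_iff]
  exact (card_fiber_eq _ _).symm.trans (card_rootCycle_fiber Γ hm P.out.2)

theorem cardStab_ne_zero : P.cardStab ≠ 0 := fun h => by
  have hcount := P.count_mul_cardStab P.len_pos
  rw [h, mul_zero, if_pos dvd_rfl] at hcount
  exact P.len_pos.ne hcount

theorem count_eq {m : ℕ} (hm : 0 < m) :
    (P.count m : ℂ) = if P.len ∣ m then P.len * (1 / P.cardStab : ℂ) else 0 := by
  have hne : (P.cardStab : ℂ) ≠ 0 := by exact_mod_cast P.cardStab_ne_zero
  have h := congrArg (fun n : ℕ => (n : ℂ)) (P.count_mul_cardStab hm)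
  push_cast at h
  rw [eq_div_of_mul_eq hne h, ite_div, zero_div, mul_one_div]

theorem hasSum_pow_div_mul_count {u : ℂ} (hu : ‖u‖ < 1) :
    HasSum (fun m : ℕ => u ^ m / m * P.count m)
      (1 / (P.cardStab : ℂ) * -log (1 - u ^ P.len)) := by
  refine (hasSum_pow_div_mul_ite_dvd P.len_pos hu _).congr_fun fun m => ?_
  rcases m.eq_zero_or_pos with rfl | hm
  · simp
  · rw [P.count_eq hm]

end PrimeClass

theorem eulerFactor_eq_exp {u : ℂ} (hu : ‖u‖ < 1) (P : PrimeClass G Γ) :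
    eulerFactor G Γ u P = exp (1 / (P.cardStab : ℂ) * -log (1 - u ^ P.len)) := by
  have hul : ‖u ^ P.len‖ < 1 := by
    rw [norm_pow]
    exact pow_lt_one₀ (norm_nonneg u) hu P.len_pos.ne'
  rw [mul_neg, ← neg_mul, mul_comm,
    ← cpow_def_of_ne_zero (isUnit_one_sub_of_norm_lt_one hul).ne_zero]
  rfl

variable [G.LocallyFinite] {q : ℕ} [Finite (orbitRel.Quotient Γ V)] [IsCancelSMul Γ V]

theorem card_orbits_reducedPaths_eq_powerTrace (hreg : G.IsRegularOfDegree (q + 1)) {m : ℕ}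
    (hm : 0 < m) :
    (Nat.card (orbitRel.Quotient Γ (reducedPaths G Γ m)) : ℂ)
      = powerTrace G hreg Γ m + if 2 ∣ m then ((2 : ℕ) : ℂ) * -eulerChar G Γ else 0 := by
  let _ := Fintype.ofFinite (orbitRel.Quotient Γ V)
  obtain ⟨m, rfl⟩ := Nat.exists_eq_add_one.2 hm
  rw [card_orbits_reducedPaths Γ hm, sum_ncard_reducedWalks Γ hreg m, eulerChar_eq G Γ hreg]
  simp only [even_iff_two_dvd]
  congr 2
  push_cast
  ring

theorem hasSum_pow_div_mul_card_orbits_reducedPaths (hreg : G.IsRegularOfDegree (q + 1))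
    (hq : 1 ≤ q) {u : ℂ} (hu : ‖u‖ < 1 / q) :
    HasSum (fun m : ℕ => u ^ m / m * Nat.card (orbitRel.Quotient Γ (reducedPaths G Γ m)))
      (∑' m : ℕ, u ^ m / m * powerTrace G hreg Γ m + eulerChar G Γ * log (1 - u ^ 2)) := by
  have htrace := (hasSum_powerTrace G hreg Γ hq hu).summable.hasSum
  have heuler := hasSum_pow_div_mul_ite_dvd two_pos (norm_lt_one_of_lt_one_div hq hu)
    (-(eulerChar G Γ : ℂ))
  rw [neg_mul_neg] at heuler
  refine (htrace.add heuler).congr_fun fun m => ?_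
  rcases m.eq_zero_or_pos with rfl | hm
  · simp
  · rw [card_orbits_reducedPaths_eq_powerTrace hreg hm, mul_add]

omit [IsCancelSMul Γ V] in
theorem zeta_eq_exp (hreg : G.IsRegularOfDegree (q + 1)) (hq : 1 ≤ q) {u : ℂ}
    (hu : ‖u‖ < 1 / q) :
    zeta G hreg Γ u
      = exp (∑' m : ℕ, u ^ m / m * powerTrace G hreg Γ m + eulerChar G Γ * log (1 - u ^ 2)) := by
  rw [zeta, detΓ_deltaOp_eq_exp G hreg Γ hq hu, ← exp_neg, neg_neg,
    cpow_def_of_ne_zero (one_sub_sq_ne_zero hq (mem_Omega_of_norm_lt hq hu)), ← exp_add,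
    add_comm, mul_comm]

theorem hasProd_eulerFactor (hreg : G.IsRegularOfDegree (q + 1)) (hq : 1 ≤ q) {u : ℂ}
    (hu : ‖u‖ < 1 / q) : HasProd (eulerFactor G Γ u) (zeta G hreg Γ u) := by
  have hu1 : ‖u‖ < 1 := norm_lt_one_of_lt_one_div hq hu
  have hlog : HasSum (fun P : PrimeClass G Γ => 1 / (P.cardStab : ℂ) * -log (1 - u ^ P.len)) _ :=
    hasSum_swap_mul_natCast
      (fun m hm => PrimeClass.hasSum_count (Nat.pos_of_ne_zero fun h => hm (by simp [h])))
      (hasSum_pow_div_mul_card_orbits_reducedPaths hreg hq hu)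
      fun P => P.hasSum_pow_div_mul_count hu1
  rw [zeta_eq_exp hreg hq hu, funext (eulerFactor_eq_exp hu1)]
  exact hlog.cexp

end EulerProduct

end IharaPeriodic

open IharaPeriodic in
theorem mainTheorem6_general {V : Type*} (G : SimpleGraph V) [G.LocallyFinite]
    (q : ℕ) (hq : 1 ≤ q) (hreg : G.IsRegularOfDegree (q + 1))
    (Γ : Subgroup (G ≃g G)) (hfree : ∀ γ ∈ Γ, γ ≠ 1 → ∀ v : V, γ v ≠ v)
    [Finite (MulAction.orbitRel.Quotient Γ V)] :
    (∀ u : ℂ, ‖u‖ < 1 / q →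
      HasProd (eulerFactor G Γ u) (zeta G hreg Γ u)) ∧
    (∀ u ∈ Omega q, InDetDomain (deltaOp G hreg u)) ∧
    ∀ u ∈ Omega q, u ≠ 0 →
      1 / (q * u) ∈ Omega q ∧
      completedΛ G hreg Γ u
        = (-1) ^ cardVB G Γ * completedΛ G hreg Γ (1 / (q * u)) ∧
      completedξ G hreg Γ u = completedξ G hreg Γ (1 / (q * u)) ∧
      completedΞ G hreg Γ u = completedΞ G hreg Γ (1 / (q * u)) := by
  have := isCancelSMul_of_free hfree
  exact ⟨fun _ hu => hasProd_eulerFactor hreg hq hu,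
    fun _ hu => inDetDomain_deltaOp G hreg hq hu,
    fun _ hu hu0 => ⟨one_div_mem_Omega hq hu hu0, completedΛ_functional_equation G hreg Γ hq hu hu0,
      completedξ_functional_equation G hreg Γ hq hu hu0,
      completedΞ_functional_equation G hreg Γ hq hu hu0⟩⟩

theorem mainTheorem6 {V : Type*} [Countable V] (G : SimpleGraph V) [G.LocallyFinite]
    (q : ℕ) (hq : 1 ≤ q) (hreg : G.IsRegularOfDegree (q + 1))
    (Γ : Subgroup (G ≃g G)) (hfree : ∀ γ ∈ Γ, γ ≠ 1 → ∀ v : V, γ v ≠ v)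
    [Finite (MulAction.orbitRel.Quotient Γ V)] :
    (∀ u : ℂ, ‖u‖ < 1 / q →
      HasProd (IharaPeriodic.eulerFactor G Γ u) (IharaPeriodic.zeta G hreg Γ u)) ∧
    (∀ u ∈ IharaPeriodic.Omega q, IharaPeriodic.InDetDomain (IharaPeriodic.deltaOp G hreg u)) ∧
    ∀ u ∈ IharaPeriodic.Omega q, u ≠ 0 →
      1 / (q * u) ∈ IharaPeriodic.Omega q ∧
      IharaPeriodic.completedΛ G hreg Γ u
        = (-1) ^ IharaPeriodic.cardVB G Γ * IharaPeriodic.completedΛ G hreg Γ (1 / (q * u)) ∧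
      IharaPeriodic.completedξ G hreg Γ u = IharaPeriodic.completedξ G hreg Γ (1 / (q * u)) ∧
      IharaPeriodic.completedΞ G hreg Γ u = IharaPeriodic.completedΞ G hreg Γ (1 / (q * u)) :=
  mainTheorem6_general G q hq hreg Γ hfree
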